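/- **Setting (qCCS).** Fix sets $cChan$ and $qChan$ of classical and quantum channels, a countably infinite set $qVar$ of quantum variables, data expressions $e$ over $\mathbb R$ (built from classical variables, real constants and function symbols), and boolean expressions $b$ (containing true, false and the comparisons $>,<,\ge,\le,=$ of data expressions, and closed under $\neg,\wedge,\vee,\to$). Process terms, identified up to renaming of bound variables, are $$P,Q ::= \mathbf 0 \mid \tau.P \mid c?x.P \mid c!e.P \mid \mathtt c?q.P \mid \mathtt c!q.P \mid \mathcal E[\tilde q].P \mid M[\tilde q;x].P \mid P+Q \mid P\,\|\,Q \mid P[f] \mid P\backslash L \mid \mathbf{if}\ b\ \mathbf{then}\ P \mid A(\tilde q;\tilde x),$$ where $c\in cChan$, $\mathtt c\in qChan$; $\tilde q$ is a tuple of distinct quantum variables (non-empty in $\mathcal E[\tilde q]$ and $M[\tilde q;x]$); $\mathcal E$ is a trace-preserving super-operator (completely positive trace-preserving map) and $M=\sum_i\lambda_iE^i$ a non-degenerate projective measurement on the qubits $\tilde q$; $f$ maps classical channels to classical channels and quantum channels to quantum channels; $L\subseteq cChan\cup qChan$; and each constant has a defining equation $A(\tilde q;\tilde x):=P$ with $P$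 legal and its free quantum and classical variables among $\tilde q$ and $\tilde x$. The variable $x$ is bound in $c?x.P$ and $M[\tilde q;x].P$, and $q$ is bound in $\mathtt c?q.P$. The set $qv(P)$ of free quantum variables is defined as usual, with $qv(A(\tilde q;\tilde x))=\tilde q$. A process is *legal* if $q\notin qv(P)$ in every subterm $\mathtt c!q.P$ and $qv(P)\cap qv(Q)=\emptyset$ in every subterm $P\|Q$; processes are assumed legal, and *closed* if they have no free classical variable. Let $\mathcal H_S=\bigotimes_{q\in S}\mathbb C^2$ for $S\subseteq qVar$ (for infinite $S$: the separable Hilbert space whose orthonormal basis consists of the product basis states in which only finitely many qubits are in state $|1\rangle$), and $\mathcal H=\mathcal H_{qVar}$. A *configuration* is a pair $\mathcal C=\langle P,\rho\rangle$ of a closed process and a density operator on $\mathcal H$; $qv(\mathcal C)=qv(P)$ and $\mathrm{ptr}(\mathcal C)=\mathrm{tr}_{qv(P)}(\rho)$. Put $\mathcal C\|R=\langle P\|R,\rho\rangle$, and $\mathcal E(\mathcal C)=\langle P,\mathcal E(\rho)\rangle$ for $\mathcal E\in\mathcal{SO}(\mathcal H_{\overline{qv(\mathcal C)}})$, the trace-preserving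 super-operators on the qubits outside $qv(\mathcal C)$ (acting as the identity on the others). Actions are $\tau$, $c?v$, $c!v$ ($v\in\mathbb R$), $\mathtt c?r$, $\mathtt c!r$ ($r\in qVar$); $qbv(\mathtt c?r)=\{r\}$ and $qbv(\alpha)=\emptyset$ for all other $\alpha$; $cn(\alpha)$ is the set of channels in $\alpha$. Operations on processes are extended to distributions over configurations. The rules (with the symmetric forms for $\|$ and $+$; point distributions are written as configurations) are: - $\langle\tau.P,\rho\rangle\xrightarrow{\tau}\langle P,\rho\rangle$; $\langle c?x.P,\rho\rangle\xrightarrow{c?v}\langle P[v/x],\rho\rangle$; $\langle c!e.P,\rho\rangle\xrightarrow{c!v}\langle P,\rho\rangle$ if $e$ has value $v$; $\langle\mathtt c?q.P,\rho\rangle\xrightarrow{\mathtt c?r}\langle P[r/q],\rho\rangle$ if $r\notin qv(\mathtt c?q.P)$; $\langle\mathtt c!q.P,\rho\rangle\xrightarrow{\mathtt c!q}\langle P,\rho\rangle$; - $\langle\mathcal E[\tilde q].P,\rho\rangle\xrightarrow{\tau}\langle P,\mathcal E_{\tilde q}(\rho)\rangle$; $\langle M[\tilde q;x].P,\rho\rangle\xrightarrow{\tau}\sum_i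 p_i\langle P[\lambda_i/x],E^i_{\tilde q}\rho E^i_{\tilde q}/p_i\rangle$ with $p_i=\mathrm{tr}(E^i_{\tilde q}\rho)$ (terms with $p_i=0$ omitted); - if $\langle P_1,\rho\rangle\xrightarrow{a}\langle P_1',\rho\rangle$ and $\langle P_2,\rho\rangle\xrightarrow{b}\langle P_2',\rho\rangle$ with $(a,b)=(c?v,c!v)$ or $(\mathtt c?r,\mathtt c!r)$, then $\langle P_1\|P_2,\rho\rangle\xrightarrow{\tau}\langle P_1'\|P_2',\rho\rangle$; - if $\langle P,\rho\rangle\xrightarrow{\alpha}\Delta$, then $\langle P\|Q,\rho\rangle\xrightarrow{\alpha}\Delta\|Q$ provided $qbv(\alpha)\cap qv(Q)=\emptyset$; $\langle P+Q,\rho\rangle\xrightarrow{\alpha}\Delta$; $\langle P[f],\rho\rangle\xrightarrow{f(\alpha)}\Delta[f]$; $\langle P\backslash L,\rho\rangle\xrightarrow{\alpha}\Delta\backslash L$ provided $cn(\alpha)\cap L=\emptyset$; $\langle\mathbf{if}\ b\ \mathbf{then}\ P,\rho\rangle\xrightarrow{\alpha}\Delta$ provided $b$ is true; - if $\langle P[\tilde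 v/\tilde x,\tilde r/\tilde q],\rho\rangle\xrightarrow{\alpha}\Delta$ and $A(\tilde q;\tilde x):=P$, then $\langle A(\tilde r;\tilde v),\rho\rangle\xrightarrow{\alpha}\Delta$. The transitions of configurations are the derivable $\mathcal C\xrightarrow{\alpha}\Delta$ that respect the convention that bound variables differ from free ones, that is, $qbv(\alpha)\cap qv(\mathcal C)=\emptyset$ (the variable received in an input $\mathtt c?r$ is not free in $\mathcal C$). **Weak transitions.** For $\mathcal R\subseteq S\times\mathcal D(S)$ (states to discrete distributions), the lifting $\mathcal R^\dagger\subseteq\mathcal D(S)\times\mathcal D(S)$ is the smallest relation that contains $(\overline s,\Theta)$ whenever $s\,\mathcal R\,\Theta$, where $\overline s$ is the point distribution, and is closed under finite convex combinations (of pairs). For $\mathcal R\subseteq S\times S$, $\mathcal R^\dagger$ is the lifting of $\{(s,\overline t)\mid s\,\mathcal R\,t\}$. Transition relations between distributions are the liftings of those above. Write $\mathcal C\xrightarrow{\hat\tau}\Delta$ if $\mathcal C\xrightarrow{\tau}\Delta$ or $\Delta=\overline{\mathcal C}$; $\stackrel{\hat\tau}{\Rightarrow}$ is the reflexive transitive closure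 of the lifting of $\xrightarrow{\hat\tau}$, and for $\alpha\neq\tau$, $\stackrel{\hat\alpha}{\Rightarrow}$ is $\stackrel{\hat\tau}{\Rightarrow}\xrightarrow{\alpha}\stackrel{\hat\tau}{\Rightarrow}$. **Open bisimilarity.** A relation $\mathcal R$ on configurations is a *weak open simulation* if $\mathcal C\,\mathcal R\,\mathcal D$ implies $qv(\mathcal C)=qv(\mathcal D)$, $\mathrm{ptr}(\mathcal C)=\mathrm{ptr}(\mathcal D)$, and for all $\mathcal E\in\mathcal{SO}(\mathcal H_{\overline{qv(\mathcal C)}})$, whenever $\mathcal E(\mathcal C)\xrightarrow{\alpha}\Delta$ there is $\Theta$ with $\mathcal E(\mathcal D)\stackrel{\hat\alpha}{\Rightarrow}\Theta$ and $\Delta\,\mathcal R^\dagger\,\Theta$. Weak open bisimilarity $\approx_o$ is the largest $\mathcal R$ such that $\mathcal R$ and $\mathcal R^{-1}$ are weak open simulations. **Reduction barbed congruence.** For $c\in cChan$ let $V_c(\Delta)=\sum\{\Delta(\mathcal C)\mid\mathcal C\xrightarrow{c!v}\text{ for some }v\}$, and write $\mathcal C\Downarrow_c^{\ge p}$ if $\mathcal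 C\stackrel{\hat\tau}{\Rightarrow}\Delta$ for some $\Delta$ with $V_c(\Delta)\ge p$. Reduction barbed congruence $\approx_r$ is the largest relation $\mathcal R$ on configurations such that $\mathcal C\,\mathcal R\,\mathcal D$ implies: 1. (barb-preserving) $\mathcal C\Downarrow_c^{\ge p}$ iff $\mathcal D\Downarrow_c^{\ge p}$, for all $c\in cChan$ and all $p$; 2. (reduction-closed) whenever $\mathcal C\stackrel{\hat\tau}{\Rightarrow}\Delta$ there is $\Theta$ with $\mathcal D\stackrel{\hat\tau}{\Rightarrow}\Theta$ and $\Delta\,\mathcal R^\dagger\,\Theta$, and whenever $\mathcal D\stackrel{\hat\tau}{\Rightarrow}\Theta$ there is $\Delta$ with $\mathcal C\stackrel{\hat\tau}{\Rightarrow}\Delta$ and $\Delta\,\mathcal R^\dagger\,\Theta$; 3. (compositional) $(\mathcal C\|R)\,\mathcal R\,(\mathcal D\|R)$ for every closed process $R$ with $qv(R)\cap(qv(\mathcal C)\cup qv(\mathcal D))=\emptyset$, and $\mathcal E(\mathcal C)\,\mathcal R\,\mathcal E(\mathcal D)$ for every $\mathcal E\in\mathcal{SO}(\mathcal H_{\overline{qv(\mathcal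 C)}})$; 4. $qv(\mathcal C)=qv(\mathcal D)$ and $\mathrm{ptr}(\mathcal C)=\mathrm{ptr}(\mathcal D)$. **Theorem (Completeness).** For all qCCS configurations $\mathcal C,\mathcal D$: if $\mathcal C\approx_r\mathcal D$ then $\mathcal C\approx_o\mathcal D$. -/

import Mathlib

open scoped ComplexOrder ENNReal

namespace QCCS

/-! ## Quantum states and super-operators

For a set `ι` of qubits, `H_ι` is the tensor product of the two-dimensional spaces of its members: the
Hilbert space with orthonormal (computational) basis `|a⟩`, `a : Finset ι`, where `a` is the finite
set of the qubits that are in state `|1⟩`. It has dimension `2 ^ |ι|` for finite `ι` and is separable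
and infinite-dimensional for countably infinite `ι`. Operators are given by their matrices in this
basis. A matrix that is positive semidefinite and has a summable diagonal is the same thing as a
positive trace-class operator. -/

/-- Matrices of operators on `H_ι`. -/
abbrev Op (ι : Type) : Type := Matrix (Finset ι) (Finset ι) ℂ

/-- The trace-class operators on `H_ι`: the span of the positive ones. For finite `ι` these are all
operators. -/
def traceClass (ι : Type) : Submodule ℂ (Op ι) :=
  Submodule.span ℂ {A | A.PosSemidef ∧ Summable fun a => A a a}

noncomputable def trace {ι : Type} (A : Op ι) : ℂ := ∑' a, A a a

/-- Density operators: positive operators of trace one. -/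
structure Density (ι : Type) where
  mat : Op ι
  posSemidef : mat.PosSemidef
  trace_one : HasSum (fun a => mat a a) 1

/-- `SO(H_ι)`: the completely positive and trace-preserving linear maps. In `completelyPositive`, `J`
is an orthonormal basis of the auxiliary space, and an operator on `H' ⊗ H_ι` is given by its blocks
`A j k`. -/
structure SuperOp (ι : Type) where
  map : traceClass ι →ₗ[ℂ] traceClass ι
  completelyPositive : ∀ (J : Type) (A : J → J → traceClass ι),
    (Matrix.of fun x y : J × Finset ι => (A x.1 y.1 : Op ι) x.2 y.2).PosSemidef →
    (Matrix.of fun x y : J × Finset ι => (map (A x.1 y.1) : Op ι) x.2 y.2).PosSemidef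
  tracePreserving : ∀ A : traceClass ι, trace (map A : Op ι) = trace (A : Op ι)

section Local
variable {ι κ : Type} (e : ι ↪ κ)

/-- Let `e` embed the systems `ι` into the systems `κ`. A basis label `f` of `H_κ` is split into its
part inside the image of `e` (a basis label of `H_ι`) and its part outside; `glue` recombines. -/
noncomputable def inside (f : Finset κ) : Finset ι := f.preimage e e.injective.injOn

open Classical in
noncomputable def outside (f : Finset κ) : Finset κ := f.filter (· ∉ Set.range e)

open Classical in
noncomputable def glue (a : Finset ι) (g : Finset κ) : Finset κ := a.map e ∪ g

/-- The block `⟨g| ρ |h⟩` of `ρ ∈ L(H_κ)`, an operator on `H_ι`, where `g` and `h` are basis labels of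
the systems outside `ι`: seeing `H_κ` as `H_ι ⊗ H_rest`, `ρ = ∑_{g,h} block g h ⊗ |g⟩⟨h|`. -/
noncomputable def block (e : ι ↪ κ) (ρ : Op κ) (g h : Finset κ) : Op ι :=
  Matrix.of fun a b => ρ (glue e a g) (glue e b h)

/-- The basis labels of the systems outside the image of `e`. -/
abbrev Outer : Type := {g : Finset κ // ∀ k ∈ g, k ∉ Set.range e}

noncomputable def outer (f : Finset κ) : Outer e :=
  ⟨outside e f, fun k hk => by classical exact (Finset.mem_filter.1 hk).2⟩

theorem glue_inside_outside (f : Finset κ) : glue e (inside e f) (outside e f) = f := by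
  classical
  ext k
  simp only [glue, inside, outside, Finset.mem_union, Finset.mem_map, Finset.mem_preimage,
    Finset.mem_filter]
  constructor
  · rintro (⟨a, ha, rfl⟩ | h)
    · exact ha
    · exact h.1
  · intro hk
    by_cases h : k ∈ Set.range e
    · obtain ⟨a, rfl⟩ := h
      exact Or.inl ⟨a, hk, rfl⟩
    · exact Or.inr ⟨hk, h⟩

theorem inside_glue (a : Finset ι) (g : Outer e) : inside e (glue e a g.1) = a := by
  classical
  ext k
  simp only [glue, inside, Finset.mem_union, Finset.mem_map, Finset.mem_preimage]
  constructor
  · rintro (⟨b, hb, h⟩ | h)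
    · exact e.injective h ▸ hb
    · exact absurd ⟨k, rfl⟩ (g.2 _ h)
  · exact fun h => Or.inl ⟨k, h, rfl⟩

theorem outside_glue (a : Finset ι) (g : Outer e) : outside e (glue e a g.1) = g.1 := by
  classical
  ext k
  simp only [glue, outside, Finset.mem_union, Finset.mem_map, Finset.mem_filter]
  constructor
  · rintro ⟨⟨b, hb, rfl⟩ | h, h'⟩
    · exact absurd ⟨b, rfl⟩ h'
    · exact h
  · exact fun h => ⟨Or.inr h, g.2 _ h⟩

/-- The basis of `H_κ` is the product of the basis of `H_ι` and that of the rest. -/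
noncomputable def splitEquiv : Outer e × Finset ι ≃ Finset κ where
  toFun x := glue e x.2 x.1.1
  invFun f := (outer e f, inside e f)
  left_inv x := by
    refine Prod.ext (Subtype.ext ?_) ?_
    · exact outside_glue e _ _
    · exact inside_glue e _ _
  right_inv f := glue_inside_outside e f

theorem posSemidef_compress {n : Type} {M : Matrix (Bool × n) (Bool × n) ℂ} (hM : M.PosSemidef)
    (u : ℂ) : (Matrix.of fun a b => M (false, a) (false, b) + u * M (false, a) (true, b)
      + star u * M (true, a) (false, b) + star u * u * M (true, a) (true, b)).PosSemidef := by
  classical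
  have hH : ∀ x y, star (M x y) = M y x := fun x y => hM.1.apply y x
  refine ⟨?_, fun x => ?_⟩
  · ext a b
    simp only [Matrix.conjTranspose_apply, Matrix.of_apply, star_add, star_mul', hH, star_star]
    ring
  · have h := hM.2 (x.mapDomain (Prod.mk false) + (u • x).mapDomain (Prod.mk true))
    refine h.trans_eq ?_
    have key : ∀ F : (Bool × n) → ℂ → ℂ, (∀ i, F i 0 = 0) → (∀ i a b, F i (a + b) = F i a + F i b) →
        (x.mapDomain (Prod.mk false) + (u • x).mapDomain (Prod.mk true)).sum F
          = x.sum fun i a => F (false, i) a + F (true, i) (u * a) := by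
      intro F h0 ha
      rw [Finsupp.sum_add_index' h0 ha, Finsupp.sum_mapDomain_index h0 ha,
        Finsupp.sum_mapDomain_index h0 ha, Finsupp.sum_smul_index (fun i => h0 _),
        Finsupp.sum_add]
    rw [key]
    · refine Finsupp.sum_congr fun i _ => ?_
      rw [key _ (by simp) (by intros; ring), key _ (by simp) (by intros; ring), ← Finsupp.sum_add]
      refine Finsupp.sum_congr fun j _ => ?_
      simp only [Matrix.of_apply, star_mul']
      ring
    · intro i; simp
    · intro i a b
      rw [← Finsupp.sum_add]
      refine Finsupp.sum_congr fun j _ => ?_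
      rw [star_add]; ring

theorem summable_of_le {α : Type} {f g : α → ℂ} (h0 : ∀ a, 0 ≤ f a) (h : ∀ a, f a ≤ g a)
    (hg : Summable g) : Summable f := by
  have h1 : Summable fun a => (f a).re :=
    Summable.of_nonneg_of_le (fun a => (Complex.le_def.1 (h0 a)).1)
      (fun a => (Complex.le_def.1 (h a)).1) (Complex.reCLM.summable hg)
  have h2 : f = fun a => (((f a).re : ℝ) : ℂ) := by
    funext a
    refine Complex.ext (by simp) ?_
    simpa using (Complex.le_def.1 (h0 a)).2.symm
  rw [h2]
  exact Complex.ofRealCLM.summable h1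

/-- The blocks of a density operator are trace class (by polarisation). -/
theorem block_mem (ρ : Density κ) (g h : Outer e) :
    block e ρ.mat g.1 h.1 ∈ traceClass ι := by
  have hs : ∀ g : Outer e, Summable fun a => block e ρ.mat g.1 g.1 a a := fun g => by
    have := (((splitEquiv e).summable_iff (f := fun f => ρ.mat f f)).2 ρ.trace_one.summable)
    exact this.prod_factor g
  set M : Matrix (Bool × Finset ι) (Bool × Finset ι) ℂ :=
    ρ.mat.submatrix (fun x => glue e x.2 (if x.1 then h.1 else g.1))
      (fun x => glue e x.2 (if x.1 then h.1 else g.1)) with hMdef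
  have hM : M.PosSemidef := ρ.posSemidef.submatrix _
  let B : ℂ → Op ι := fun u => Matrix.of fun a b => M (false, a) (false, b)
      + u * M (false, a) (true, b) + star u * M (true, a) (false, b)
      + star u * u * M (true, a) (true, b)
  have hBp : ∀ u, (B u).PosSemidef := fun u => posSemidef_compress hM u
  have hBs : ∀ u, Summable fun a => B u a a := fun u => by
    refine summable_of_le (g := fun a => 2 * (block e ρ.mat g.1 g.1 a a)
      + 2 * (star u * u) * (block e ρ.mat h.1 h.1 a a)) (fun a => (hBp u).diag_nonneg) ?_
      (((hs g).mul_left _).add ((hs h).mul_left _))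
    intro a
    have h1 : 0 ≤ B (-u) a a := (hBp (-u)).diag_nonneg
    have h2 : 2 * (block e ρ.mat g.1 g.1 a a) + 2 * (star u * u) * (block e ρ.mat h.1 h.1 a a)
        = B u a a + B (-u) a a := by
      simp [B, M, block]
      ring
    rw [h2]
    exact le_add_of_nonneg_right h1
  have hB : ∀ u, B u ∈ traceClass ι := fun u => Submodule.subset_span ⟨hBp u, hBs u⟩
  have hI : Complex.I * Complex.I = -1 := Complex.I_mul_I
  have : block e ρ.mat g.1 h.1 = (1 / 4 : ℂ) • (B 1 + (-1 : ℂ) • B (-1)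
      + (-Complex.I) • B Complex.I + Complex.I • B (-Complex.I)) := by
    ext a b
    simp [B, M, block]
    ring_nf
    simp [Complex.I_sq]
    ring
  rw [this]
  exact Submodule.smul_mem _ _ (add_mem (add_mem (add_mem (hB _) (Submodule.smul_mem _ _ (hB _)))
    (Submodule.smul_mem _ _ (hB _))) (Submodule.smul_mem _ _ (hB _)))

theorem summable_diag {ι : Type} {A : Op ι} (hA : A ∈ traceClass ι) : Summable fun a => A a a := by
  unfold traceClass at hA
  induction hA using Submodule.span_induction with
  | mem A h => exact h.2
  | zero => simp
  | add A B _ _ hA hB => exact hA.add hB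
  | smul c A _ hA => exact hA.mul_left c

noncomputable def tcBlock (ρ : Density κ) (g h : Outer e) : traceClass ι :=
  ⟨block e ρ.mat g.1 h.1, block_mem e ρ g h⟩

theorem tcBlock_posSemidef (ρ : Density κ) :
    (Matrix.of fun x y : Outer e × Finset ι => (tcBlock e ρ x.1 y.1 : Op ι) x.2 y.2).PosSemidef :=
  ρ.posSemidef.submatrix fun x : Outer e × Finset ι => glue e x.2 x.1.1

/-- `(E ⊗ id)(ρ)`: the super-operator `E` is applied to each block of `ρ`. -/
noncomputable def SuperOp.applyMat (E : SuperOp ι) (ρ : Density κ) : Op κ :=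
  Matrix.of fun f f' =>
    (E.map (tcBlock e ρ (outer e f) (outer e f')) : Op ι) (inside e f) (inside e f')

theorem SuperOp.apply_block_posSemidef (E : SuperOp ι) (ρ : Density κ) :
    (Matrix.of fun x y : Outer e × Finset ι =>
      (E.map (tcBlock e ρ x.1 y.1) : Op ι) x.2 y.2).PosSemidef :=
  E.completelyPositive (Outer e) (fun g h => tcBlock e ρ g h) (tcBlock_posSemidef e ρ)

theorem hasSum_prod_of_nonneg {α β : Type} {d : α × β → ℂ} (h0 : ∀ x, 0 ≤ d x) {t : α → ℂ}
    (h1 : ∀ g, HasSum (fun a => d (g, a)) (t g)) {s : ℂ} (h2 : HasSum t s) : HasSum d s := by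
  have hdr : ∀ x, d x = (((d x).re : ℝ) : ℂ) := fun x => by
    refine Complex.ext (by simp) ?_
    simpa using (Complex.le_def.1 (h0 x)).2.symm
  have h1' : ∀ g, HasSum (fun a => (d (g, a)).re) (t g).re :=
    fun g => Complex.reCLM.hasSum (h1 g)
  have hsum : Summable fun x => (d x).re := by
    rw [summable_prod_of_nonneg (fun x => (Complex.le_def.1 (h0 x)).1)]
    exact ⟨fun g => (h1' g).summable,
      (Complex.reCLM.hasSum h2).summable.congr fun g => ((h1' g).tsum_eq).symm⟩
  have hsum' : Summable d := (Complex.ofRealCLM.summable hsum).congr fun x => (hdr x).symm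
  rw [h2.unique (hsum'.hasSum.prod_fiberwise h1)]
  exact hsum'.hasSum

theorem SuperOp.applyMat_hasSum (E : SuperOp ι) (ρ : Density κ) :
    HasSum (fun f => E.applyMat e ρ f f) 1 := by
  have h1 : HasSum (fun x : Outer e × Finset ι => (tcBlock e ρ x.1 x.1 : Op ι) x.2 x.2) 1 :=
    (splitEquiv e).hasSum_iff.2 ρ.trace_one
  have h2 : HasSum (fun g => trace (tcBlock e ρ g g : Op ι)) 1 :=
    h1.prod_fiberwise fun g => (summable_diag (tcBlock e ρ g g).2).hasSum
  have h3 : ∀ g, HasSum (fun a => (E.map (tcBlock e ρ g g) : Op ι) a a)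
      (trace (tcBlock e ρ g g : Op ι)) := fun g => by
    rw [← E.tracePreserving]
    exact (summable_diag (E.map (tcBlock e ρ g g)).2).hasSum
  have h4 : HasSum (fun x : Outer e × Finset ι => (E.map (tcBlock e ρ x.1 x.1) : Op ι) x.2 x.2) 1 :=
    hasSum_prod_of_nonneg (fun x => (E.apply_block_posSemidef e ρ).diag_nonneg (i := x)) h3 h2
  exact ((splitEquiv e).symm.hasSum_iff (f := fun x : Outer e × Finset ι =>
    (E.map (tcBlock e ρ x.1 x.1) : Op ι) x.2 x.2)).2 h4

/-- The density operator `E_{e}(ρ) = (E ⊗ id)(ρ)`. -/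
noncomputable def SuperOp.apply (E : SuperOp ι) (ρ : Density κ) : Density κ where
  mat := E.applyMat e ρ
  posSemidef := (E.apply_block_posSemidef e ρ).submatrix fun f => (outer e f, inside e f)
  trace_one := E.applyMat_hasSum e ρ

/-- `A_{e} ρ = (A ⊗ I) ρ` for an operator `A` on the finitely many qubits `e 0, e 1, …`. -/
noncomputable def leftMul {k : ℕ} (e : Fin k ↪ κ) (A : Op (Fin k)) (ρ : Op κ) : Op κ :=
  Matrix.of fun f f' =>
    (A * block e ρ (outside e f) (outside e f')) (inside e f) (inside e f')

/-- `A_{e} ρ A_{e} = (A ⊗ I) ρ (A ⊗ I)`. -/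
noncomputable def sandwich {k : ℕ} (e : Fin k ↪ κ) (A : Op (Fin k)) (ρ : Op κ) : Op κ :=
  Matrix.of fun f f' =>
    (A * block e ρ (outside e f) (outside e f') * A) (inside e f) (inside e f')

end Local

/-- A non-degenerate projective measurement on `k` qubits: a Hermitian operator whose eigenvalues are
simple. -/
structure Measurement (k : ℕ) where
  obs : Op (Fin k)
  herm : obs.IsHermitian
  nondegenerate : Function.Injective herm.eigenvalues

/-- The eigenvalues `λ_i` (they are pairwise distinct). -/
noncomputable def Measurement.value {k : ℕ} (M : Measurement k) (i : Finset (Fin k)) : ℝ :=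
  M.herm.eigenvalues i

/-- The projector `E^i = |u_i⟩⟨u_i|` onto the eigenspace of `λ_i`. -/
noncomputable def Measurement.proj {k : ℕ} (M : Measurement k) (i : Finset (Fin k)) : Op (Fin k) :=
  Matrix.vecMulVec (M.herm.eigenvectorBasis i).ofLp (star (M.herm.eigenvectorBasis i).ofLp)

/-- The countably infinite set of quantum variables. -/
abbrev QVar : Type := ℕ

/-- The partial trace `tr_V(ρ)`, an operator on the qubits outside `V`. The entry at the basis labels
`g`, `h` of these qubits is `∑_{a ⊆ V} ⟨a ∪ g| ρ |a ∪ h⟩`. (The members of `V` in `g` and `h` are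
ignored, so that operators on the qubits outside `V` have the same type for all `V`.) -/
noncomputable def ptrace (V : Finset QVar) (ρ : Density QVar) : Op QVar :=
  Matrix.of fun g h => ∑ a ∈ V.powerset, ρ.mat (a ∪ (g \ V)) (a ∪ (h \ V))

/-! ## Syntax -/

/-- The parameters of the language: classical and quantum channels, the function and predicate symbols
from which data expressions and boolean expressions are built, and the process constants with the
numbers of their classical and quantum parameters. -/
structure Signature where
  CChan : Type
  QChan : Type
  Fn : Type
  fnArity : Fn → ℕ
  fnEval : (f : Fn) → (Fin (fnArity f) → ℝ) → ℝ
  Pr : Type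
  prArity : Pr → ℕ
  prEval : (p : Pr) → (Fin (prArity p) → ℝ) → Prop
  Const : Type
  cArity : Const → ℕ
  qArity : Const → ℕ

/-- Data expressions over the classical variables `Fin m`. -/
inductive Exp (S : Signature) (m : ℕ) : Type
  | var (i : Fin m) : Exp S m
  | val (v : ℝ) : Exp S m
  | app (f : S.Fn) (args : Fin (S.fnArity f) → Exp S m) : Exp S m

/-- The comparisons `>`, `<`, `≥`, `≤`, `=`. -/
inductive Cmp : Type
  | gt | lt | ge | le | eq

/-- Boolean expressions. -/
inductive BExp (S : Signature) (m : ℕ) : Type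
  | tt : BExp S m
  | ff : BExp S m
  | not (b : BExp S m) : BExp S m
  | and (b b' : BExp S m) : BExp S m
  | or (b b' : BExp S m) : BExp S m
  | imp (b b' : BExp S m) : BExp S m
  | cmp (o : Cmp) (e e' : Exp S m) : BExp S m
  | pred (p : S.Pr) (args : Fin (S.prArity p) → Exp S m) : BExp S m

def Exp.eval {S : Signature} {m : ℕ} (ν : Fin m → ℝ) : Exp S m → ℝ
  | .var i => ν i
  | .val v => v
  | .app f args => S.fnEval f fun i => (args i).eval ν

def Cmp.holds : Cmp → ℝ → ℝ → Prop
  | .gt, x, y => x > y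
  | .lt, x, y => x < y
  | .ge, x, y => x ≥ y
  | .le, x, y => x ≤ y
  | .eq, x, y => x = y

def BExp.eval {S : Signature} {m : ℕ} (ν : Fin m → ℝ) : BExp S m → Prop
  | .tt => True
  | .ff => False
  | .not b => ¬ b.eval ν
  | .and b b' => b.eval ν ∧ b'.eval ν
  | .or b b' => b.eval ν ∨ b'.eval ν
  | .imp b b' => b.eval ν → b'.eval ν
  | .cmp o e e' => o.holds (e.eval ν) (e'.eval ν)
  | .pred p args => S.prEval p fun i => (args i).eval ν

/-- Quantum variable occurrences under `n` quantum binders: a free name in `N` or one of the `n` bound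
variables, `none` being the innermost one. -/
abbrev QRef (N : Type) : ℕ → Type
  | 0 => N
  | n + 1 => Option (QRef N n)

/-- Process terms, up to renaming of bound variables: `m` classical variables and `n` bound quantum
variables are in scope, and free quantum variables are taken from `N`. In `cin` and `meas` the new
classical variable is `0`, the others are shifted by one; in `qin` the new quantum variable is `none`.
A classical argument of a constant is a variable or a value. -/
inductive Proc (S : Signature) (N : Type) : ℕ → ℕ → Type
  | nil {m n : ℕ} : Proc S N m n
  | tau {m n : ℕ} (P : Proc S N m n) : Proc S N m n
  | cin {m n : ℕ} (c : S.CChan) (P : Proc S N (m + 1) n) : Proc S N m n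
  | cout {m n : ℕ} (c : S.CChan) (e : Exp S m) (P : Proc S N m n) : Proc S N m n
  | qin {m n : ℕ} (c : S.QChan) (P : Proc S N m (n + 1)) : Proc S N m n
  | qout {m n : ℕ} (c : S.QChan) (q : QRef N n) (P : Proc S N m n) : Proc S N m n
  | oper {m n k : ℕ} (E : SuperOp (Fin k)) (q : Fin k → QRef N n) (P : Proc S N m n) : Proc S N m n
  | meas {m n k : ℕ} (M : Measurement k) (q : Fin k → QRef N n) (P : Proc S N (m + 1) n) :
      Proc S N m n
  | sum {m n : ℕ} (P Q : Proc S N m n) : Proc S N m n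
  | par {m n : ℕ} (P Q : Proc S N m n) : Proc S N m n
  | relabel {m n : ℕ} (P : Proc S N m n) (f : S.CChan → S.CChan) (g : S.QChan → S.QChan) :
      Proc S N m n
  | restrict {m n : ℕ} (P : Proc S N m n) (L : Set (S.CChan ⊕ S.QChan)) : Proc S N m n
  | ite {m n : ℕ} (b : BExp S m) (P : Proc S N m n) : Proc S N m n
  | const {m n : ℕ} (A : S.Const) (q : Fin (S.qArity A) → QRef N n)
      (x : Fin (S.cArity A) → Fin m ⊕ ℝ) : Proc S N m n

open Classical in
/-- The set `qv(P)` of free quantum variables. -/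
noncomputable def Proc.qv {S : Signature} {N : Type} {m n : ℕ} :
    Proc S N m n → Finset (QRef N n)
  | .nil => ∅
  | .tau P => P.qv
  | .cin _ P => P.qv
  | .cout _ _ P => P.qv
  | .qin _ P => P.qv.eraseNone
  | .qout _ q P => insert q P.qv
  | .oper _ q P => P.qv ∪ Finset.univ.image q
  | .meas _ q P => P.qv ∪ Finset.univ.image q
  | .sum P Q => P.qv ∪ Q.qv
  | .par P Q => P.qv ∪ Q.qv
  | .relabel P _ _ => P.qv
  | .restrict P _ => P.qv
  | .ite _ P => P.qv
  | .const _ q _ => Finset.univ.image q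

/-- Legal processes: a quantum variable is not referenced after it has been sent, parallel components
have no quantum variable in common, and the tuples of quantum variables in `E[q̃]`, `M[q̃; x]` and
`A(q̃; x̃)` have distinct entries (and are non-empty in the first two cases). -/
def Proc.Legal {S : Signature} {N : Type} {m n : ℕ} : Proc S N m n → Prop
  | .nil => True
  | .tau P => P.Legal
  | .cin _ P => P.Legal
  | .cout _ _ P => P.Legal
  | .qin _ P => P.Legal
  | .qout _ q P => q ∉ P.qv ∧ P.Legal
  | .oper (k := k) _ q P => 0 < k ∧ Function.Injective q ∧ P.Legal
  | .meas (k := k) _ q P => 0 < k ∧ Function.Injective q ∧ P.Legal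
  | .sum P Q => P.Legal ∧ Q.Legal
  | .par P Q => Disjoint P.qv Q.qv ∧ P.Legal ∧ Q.Legal
  | .relabel P _ _ => P.Legal
  | .restrict P _ => P.Legal
  | .ite _ P => P.Legal
  | .const _ q _ => Function.Injective q

/-- Substitution of quantum variables. -/
def Proc.qsubst {S : Signature} {N N' : Type} {m n n' : ℕ} (σ : QRef N n → QRef N' n') :
    Proc S N m n → Proc S N' m n'
  | .nil => .nil
  | .tau P => .tau (P.qsubst σ)
  | .cin c P => .cin c (P.qsubst σ)
  | .cout c e P => .cout c e (P.qsubst σ)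
  | .qin c P => .qin c (P.qsubst (n' := n' + 1) (Option.map σ))
  | .qout c q P => .qout c (σ q) (P.qsubst σ)
  | .oper E q P => .oper E (σ ∘ q) (P.qsubst σ)
  | .meas M q P => .meas M (σ ∘ q) (P.qsubst σ)
  | .sum P Q => .sum (P.qsubst σ) (Q.qsubst σ)
  | .par P Q => .par (P.qsubst σ) (Q.qsubst σ)
  | .relabel P f g => .relabel (P.qsubst σ) f g
  | .restrict P L => .restrict (P.qsubst σ) L
  | .ite b P => .ite b (P.qsubst σ)
  | .const A q x => .const A (σ ∘ q) x

/-- A classical substitution replaces each variable by a variable or a value; `liftC` extends it to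
the scope of a further bound variable. -/
def liftC {m m' : ℕ} (σ : Fin m → Fin m' ⊕ ℝ) : Fin (m + 1) → Fin (m' + 1) ⊕ ℝ :=
  Fin.cases (Sum.inl 0) fun i => (σ i).map Fin.succ id

def Exp.subst {S : Signature} {m m' : ℕ} (σ : Fin m → Fin m' ⊕ ℝ) : Exp S m → Exp S m'
  | .var i => (σ i).elim .var .val
  | .val v => .val v
  | .app f args => .app f fun i => (args i).subst σ

def BExp.subst {S : Signature} {m m' : ℕ} (σ : Fin m → Fin m' ⊕ ℝ) : BExp S m → BExp S m'
  | .tt => .tt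
  | .ff => .ff
  | .not b => .not (b.subst σ)
  | .and b b' => .and (b.subst σ) (b'.subst σ)
  | .or b b' => .or (b.subst σ) (b'.subst σ)
  | .imp b b' => .imp (b.subst σ) (b'.subst σ)
  | .cmp o e e' => .cmp o (e.subst σ) (e'.subst σ)
  | .pred p args => .pred p fun i => (args i).subst σ

/-- Substitution of classical variables. -/
def Proc.csubst {S : Signature} {N : Type} {m m' n : ℕ} (σ : Fin m → Fin m' ⊕ ℝ) :
    Proc S N m n → Proc S N m' n
  | .nil => .nil
  | .tau P => .tau (P.csubst σ)
  | .cin c P => .cin c (P.csubst (m' := m' + 1) (liftC σ))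
  | .cout c e P => .cout c (e.subst σ) (P.csubst σ)
  | .qin c P => .qin c (P.csubst σ)
  | .qout c q P => .qout c q (P.csubst σ)
  | .oper E q P => .oper E q (P.csubst σ)
  | .meas M q P => .meas M q (P.csubst (m' := m' + 1) (liftC σ))
  | .sum P Q => .sum (P.csubst σ) (Q.csubst σ)
  | .par P Q => .par (P.csubst σ) (Q.csubst σ)
  | .relabel P f g => .relabel (P.csubst σ) f g
  | .restrict P L => .restrict (P.csubst σ) L
  | .ite b P => .ite (b.subst σ) (P.csubst σ)
  | .const A q x => .const A q fun i => (x i).elim σ Sum.inr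

/-- Closed processes: no free classical variables, free quantum variables from `QVar`. -/
abbrev CProc (S : Signature) : Type := Proc S QVar 0 0

/-- `P[v/x]` for the single classical variable `x` of `P`. -/
def Proc.instC {S : Signature} (P : Proc S QVar 1 0) (v : ℝ) : CProc S :=
  P.csubst fun _ => Sum.inr v

/-- `P[r/q]` for the single bound quantum variable `q` of `P`. -/
def Proc.instQ {S : Signature} (P : Proc S QVar 0 1) (r : QVar) : CProc S :=
  P.qsubst (n' := 0) fun x : Option QVar => x.getD r

/-- The defining equations `A(q̃; x̃) := P` of the constants, where `P` is a legal term whose free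
quantum variables are among the formal parameters `q̃` and whose classical variables are among `x̃`. -/
structure Environment (S : Signature) where
  body : (A : S.Const) → Proc S (Fin (S.qArity A)) (S.cArity A) 0
  legal : ∀ A, (body A).Legal

/-- The body of `A` with actual parameters. -/
def Environment.unfold {S : Signature} (K : Environment S) (A : S.Const)
    (q : Fin (S.qArity A) → QVar) (v : Fin (S.cArity A) → ℝ) : CProc S :=
  ((K.body A).qsubst (n' := 0) q).csubst fun i => Sum.inr (v i)

/-! ## Operational semantics -/

/-- Pairs `⟨P, ρ⟩`. The configurations of the calculus are those with a legal process. -/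
structure Config (S : Signature) where
  proc : CProc S
  state : Density QVar

/-- `C ‖ R`. -/
def Config.par {S : Signature} (C : Config S) (R : CProc S) : Config S := ⟨.par C.proc R, C.state⟩

noncomputable def Config.qv {S : Signature} (C : Config S) : Finset QVar := C.proc.qv

/-- `ptr(C)`: the reduced state of the quantum variables that are not free in `C`. -/
noncomputable def Config.ptr {S : Signature} (C : Config S) : Op QVar := ptrace C.qv C.state

/-- `E(C)` for a super-operator `E` on the quantum variables outside `V`. -/
noncomputable def Config.applySO {S : Signature} {V : Finset QVar} (E : SuperOp {q : QVar // q ∉ V})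
    (C : Config S) : Config S :=
  ⟨C.proc, E.apply (Function.Embedding.subtype _) C.state⟩

/-- Actions, with the invisible action `tau`. -/
inductive Act (S : Signature) : Type
  | tau : Act S
  | cin (c : S.CChan) (v : ℝ) : Act S
  | cout (c : S.CChan) (v : ℝ) : Act S
  | qin (c : S.QChan) (r : QVar) : Act S
  | qout (c : S.QChan) (r : QVar) : Act S

/-- The quantum variables `qbv(α)` that are bound in an action: the one received by an input. -/
def Act.qbv {S : Signature} : Act S → Finset QVar
  | .qin _ r => {r}
  | _ => ∅

/-- The channel names `cn(α)`. -/
def Act.cn {S : Signature} : Act S → Set (S.CChan ⊕ S.QChan)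
  | .tau => ∅
  | .cin c _ => {Sum.inl c}
  | .cout c _ => {Sum.inl c}
  | .qin c _ => {Sum.inr c}
  | .qout c _ => {Sum.inr c}

def Act.relabel {S : Signature} (f : S.CChan → S.CChan) (g : S.QChan → S.QChan) : Act S → Act S
  | .tau => .tau
  | .cin c v => .cin (f c) v
  | .cout c v => .cout (f c) v
  | .qin c r => .qin (g c) r
  | .qout c r => .qout (g c) r

/-- The rules of the operational semantics. In `meas` the target is the distribution
`∑_i p_i ⟨P[λ_i/x], E^i ρ E^i / p_i⟩` with `p_i = tr(E^i ρ)`; the state `σ i` is determined by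
`p_i σ_i = E^i ρ E^i` whenever `p_i ≠ 0`, and has no weight when `p_i = 0`. -/
inductive Step {S : Signature} (K : Environment S) :
    Config S → Act S → PMF (Config S) → Prop
  | tau (P : CProc S) (ρ : Density QVar) :
      Step K ⟨.tau P, ρ⟩ .tau (PMF.pure ⟨P, ρ⟩)
  | cInp (c : S.CChan) (P : Proc S QVar 1 0) (ρ : Density QVar) (v : ℝ) :
      Step K ⟨.cin c P, ρ⟩ (.cin c v) (PMF.pure ⟨P.instC v, ρ⟩)
  | cOutp (c : S.CChan) (e : Exp S 0) (P : CProc S) (ρ : Density QVar) :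
      Step K ⟨.cout c e P, ρ⟩ (.cout c (e.eval Fin.elim0)) (PMF.pure ⟨P, ρ⟩)
  | cComL {P₁ P₂ P₁' P₂' : CProc S} {ρ : Density QVar} {c : S.CChan} {v : ℝ} :
      Step K ⟨P₁, ρ⟩ (.cin c v) (PMF.pure ⟨P₁', ρ⟩) →
      Step K ⟨P₂, ρ⟩ (.cout c v) (PMF.pure ⟨P₂', ρ⟩) →
      Step K ⟨.par P₁ P₂, ρ⟩ .tau (PMF.pure ⟨.par P₁' P₂', ρ⟩)
  | cComR {P₁ P₂ P₁' P₂' : CProc S} {ρ : Density QVar} {c : S.CChan} {v : ℝ} :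
      Step K ⟨P₁, ρ⟩ (.cout c v) (PMF.pure ⟨P₁', ρ⟩) →
      Step K ⟨P₂, ρ⟩ (.cin c v) (PMF.pure ⟨P₂', ρ⟩) →
      Step K ⟨.par P₁ P₂, ρ⟩ .tau (PMF.pure ⟨.par P₁' P₂', ρ⟩)
  | qInp (c : S.QChan) (P : Proc S QVar 0 1) (ρ : Density QVar) (r : QVar)
      (hr : r ∉ (Proc.qin c P : CProc S).qv) :
      Step K ⟨.qin c P, ρ⟩ (.qin c r) (PMF.pure ⟨P.instQ r, ρ⟩)
  | qOutp (c : S.QChan) (q : QVar) (P : CProc S) (ρ : Density QVar) :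
      Step K ⟨.qout c q P, ρ⟩ (.qout c q) (PMF.pure ⟨P, ρ⟩)
  | qComL {P₁ P₂ P₁' P₂' : CProc S} {ρ : Density QVar} {c : S.QChan} {r : QVar} :
      Step K ⟨P₁, ρ⟩ (.qin c r) (PMF.pure ⟨P₁', ρ⟩) →
      Step K ⟨P₂, ρ⟩ (.qout c r) (PMF.pure ⟨P₂', ρ⟩) →
      Step K ⟨.par P₁ P₂, ρ⟩ .tau (PMF.pure ⟨.par P₁' P₂', ρ⟩)
  | qComR {P₁ P₂ P₁' P₂' : CProc S} {ρ : Density QVar} {c : S.QChan} {r : QVar} :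
      Step K ⟨P₁, ρ⟩ (.qout c r) (PMF.pure ⟨P₁', ρ⟩) →
      Step K ⟨P₂, ρ⟩ (.qin c r) (PMF.pure ⟨P₂', ρ⟩) →
      Step K ⟨.par P₁ P₂, ρ⟩ .tau (PMF.pure ⟨.par P₁' P₂', ρ⟩)
  | oper {k : ℕ} (E : SuperOp (Fin k)) (e : Fin k ↪ QVar) (P : CProc S) (ρ : Density QVar) :
      Step K ⟨.oper E e P, ρ⟩ .tau (PMF.pure ⟨P, E.apply e ρ⟩)
  | meas {k : ℕ} (M : Measurement k) (e : Fin k ↪ QVar) (P : Proc S QVar 1 0) (ρ : Density QVar)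
      (p : PMF (Finset (Fin k))) (σ : Finset (Fin k) → Density QVar)
      (hp : ∀ i, HasSum (fun a => leftMul e (M.proj i) ρ.mat a a) ((p i).toReal : ℂ))
      (hσ : ∀ i, ((p i).toReal : ℂ) • (σ i).mat = sandwich e (M.proj i) ρ.mat) :
      Step K ⟨.meas M e P, ρ⟩ .tau (p.map fun i => ⟨P.instC (M.value i), σ i⟩)
  | intL {P₁ P₂ : CProc S} {ρ : Density QVar} {α : Act S} {Δ : PMF (Config S)} :
      Step K ⟨P₁, ρ⟩ α Δ → Disjoint α.qbv P₂.qv →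
      Step K ⟨.par P₁ P₂, ρ⟩ α (Δ.map fun C => ⟨.par C.proc P₂, C.state⟩)
  | intR {P₁ P₂ : CProc S} {ρ : Density QVar} {α : Act S} {Δ : PMF (Config S)} :
      Step K ⟨P₂, ρ⟩ α Δ → Disjoint α.qbv P₁.qv →
      Step K ⟨.par P₁ P₂, ρ⟩ α (Δ.map fun C => ⟨.par P₁ C.proc, C.state⟩)
  | sumL {P₁ P₂ : CProc S} {ρ : Density QVar} {α : Act S} {Δ : PMF (Config S)} :
      Step K ⟨P₁, ρ⟩ α Δ → Step K ⟨.sum P₁ P₂, ρ⟩ α Δ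
  | sumR {P₁ P₂ : CProc S} {ρ : Density QVar} {α : Act S} {Δ : PMF (Config S)} :
      Step K ⟨P₂, ρ⟩ α Δ → Step K ⟨.sum P₁ P₂, ρ⟩ α Δ
  | rel {P : CProc S} {ρ : Density QVar} {α : Act S} {Δ : PMF (Config S)}
      (f : S.CChan → S.CChan) (g : S.QChan → S.QChan) :
      Step K ⟨P, ρ⟩ α Δ →
      Step K ⟨.relabel P f g, ρ⟩ (α.relabel f g) (Δ.map fun C => ⟨.relabel C.proc f g, C.state⟩)
  | res {P : CProc S} {ρ : Density QVar} {α : Act S} {Δ : PMF (Config S)}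
      (L : Set (S.CChan ⊕ S.QChan)) :
      Step K ⟨P, ρ⟩ α Δ → Disjoint α.cn L →
      Step K ⟨.restrict P L, ρ⟩ α (Δ.map fun C => ⟨.restrict C.proc L, C.state⟩)
  | cho {P : CProc S} {ρ : Density QVar} {α : Act S} {Δ : PMF (Config S)} (b : BExp S 0) :
      Step K ⟨P, ρ⟩ α Δ → b.eval Fin.elim0 → Step K ⟨.ite b P, ρ⟩ α Δ
  | cons {ρ : Density QVar} {α : Act S} {Δ : PMF (Config S)} (A : S.Const)
      (q : Fin (S.qArity A) → QVar) (x : Fin (S.cArity A) → Fin 0 ⊕ ℝ) :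
      Step K ⟨K.unfold A q fun i => (x i).elim Fin.elim0 id, ρ⟩ α Δ →
      Step K ⟨.const A q x, ρ⟩ α Δ

/-- The transitions `C -α-> Δ` of the probabilistic labelled transition system: those derivable from
the rules, under the convention that bound variables, here the variable received by a quantum input
action, are different from the free variables of the configuration. -/
def Trans {S : Signature} (K : Environment S) (α : Act S) (C : Config S) (Δ : PMF (Config S)) : Prop :=
  Step K C α Δ ∧ Disjoint α.qbv C.qv

/-! ## Lifting and weak transitions -/

/-- The lifting of a relation between states and distributions: the smallest relation between
distributions that extends it and is closed under finite convex combinations. -/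
inductive Lift {X : Type} (R : X → PMF X → Prop) : PMF X → PMF X → Prop
  | point {s : X} {Θ : PMF X} : R s Θ → Lift R (PMF.pure s) Θ
  | linear {n : ℕ} (p : PMF (Fin n)) (Δ Θ : Fin n → PMF X) :
      (∀ i, Lift R (Δ i) (Θ i)) → Lift R (p.bind Δ) (p.bind Θ)

/-- The lifting of a relation between states. -/
def LiftRel {X : Type} (R : X → X → Prop) : PMF X → PMF X → Prop :=
  Lift fun s Θ => ∃ t, R s t ∧ Θ = PMF.pure t

/-- `C -τ̂-> Δ`. -/
def TauHat {S : Signature} (K : Environment S) (C : Config S) (Δ : PMF (Config S)) : Prop :=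
  Trans K .tau C Δ ∨ Δ = PMF.pure C

/-- `Δ =τ̂=> Θ`: the reflexive and transitive closure of the lifting of `-τ̂->`. -/
def WeakTau {S : Signature} (K : Environment S) : PMF (Config S) → PMF (Config S) → Prop :=
  Relation.ReflTransGen (Lift (TauHat K))

/-- `Δ =α̂=> Θ`. -/
def Weak {S : Signature} (K : Environment S) : Act S → PMF (Config S) → PMF (Config S) → Prop
  | .tau, Δ, Θ => WeakTau K Δ Θ
  | α, Δ, Θ => ∃ Δ' Θ', WeakTau K Δ Δ' ∧ Lift (Trans K α) Δ' Θ' ∧ WeakTau K Θ' Θ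

/-! ## Open bisimilarity and reduction barbed congruence -/

/-- `R` is a relation over configurations, that is, over pairs with legal processes. -/
def OnConfigs {S : Signature} (R : Config S → Config S → Prop) : Prop :=
  ∀ C D, R C D → C.proc.Legal ∧ D.proc.Legal

/-- Related configurations have the same free quantum variables and the same partial trace. -/
def SameEnv {S : Signature} (R : Config S → Config S → Prop) : Prop :=
  ∀ C D, R C D → C.qv = D.qv ∧ C.ptr = D.ptr

/-- Weak open simulations. -/
def IsOpenSimulation {S : Signature} (K : Environment S) (R : Config S → Config S → Prop) : Prop :=
  SameEnv R ∧
  ∀ C D, R C D → ∀ E : SuperOp {q : QVar // q ∉ C.qv}, ∀ (α : Act S) (Δ : PMF (Config S)),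
    Trans K α (C.applySO E) Δ →
      ∃ Θ, Weak K α (PMF.pure (D.applySO E)) Θ ∧ LiftRel R Δ Θ

/-- Weak open bisimulations: both `R` and its converse are weak open simulations. -/
def IsOpenBisimulation {S : Signature} (K : Environment S) (R : Config S → Config S → Prop) : Prop :=
  OnConfigs R ∧ IsOpenSimulation K R ∧ IsOpenSimulation K fun D C => R C D

/-- Weak open bisimilarity `≈ₒ`: the largest weak open bisimulation, that is, the union of all. -/
def OpenBisimilar {S : Signature} (K : Environment S) (C D : Config S) : Prop :=
  ∃ R, IsOpenBisimulation K R ∧ R C D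

/-- `V_c(Δ)`: the probability of the configurations that can output on the classical channel `c`. -/
noncomputable def barbWeight {S : Signature} (K : Environment S) (c : S.CChan)
    (Δ : PMF (Config S)) : ℝ≥0∞ :=
  ∑' C, {C : Config S | ∃ v Θ, Trans K (.cout c v) C Θ}.indicator Δ C

/-- The barb `C ⇓_c^{≥ p}`. -/
def Barb {S : Signature} (K : Environment S) (C : Config S) (c : S.CChan) (p : ℝ≥0∞) : Prop :=
  ∃ Δ, WeakTau K (PMF.pure C) Δ ∧ p ≤ barbWeight K c Δ

def BarbPreserving {S : Signature} (K : Environment S) (R : Config S → Config S → Prop) : Prop :=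
  ∀ C D, R C D → ∀ (c : S.CChan) (p : ℝ≥0∞), Barb K C c p ↔ Barb K D c p

def ReductionClosed {S : Signature} (K : Environment S) (R : Config S → Config S → Prop) : Prop :=
  ∀ C D, R C D →
    (∀ Δ, WeakTau K (PMF.pure C) Δ → ∃ Θ, WeakTau K (PMF.pure D) Θ ∧ LiftRel R Δ Θ) ∧
    (∀ Θ, WeakTau K (PMF.pure D) Θ → ∃ Δ, WeakTau K (PMF.pure C) Δ ∧ LiftRel R Δ Θ)

/-- Closure under parallel composition with processes that share no quantum variable with the two
configurations, and under super-operator application. -/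
def Compositional {S : Signature} (R : Config S → Config S → Prop) : Prop :=
  (∀ C D, R C D → ∀ Q : CProc S, Q.Legal → Disjoint Q.qv (C.qv ∪ D.qv) → R (C.par Q) (D.par Q)) ∧
  (∀ C D, R C D → ∀ E : SuperOp {q : QVar // q ∉ C.qv}, R (C.applySO E) (D.applySO E))

/-- Reduction barbed congruence `≈ᵣ`: the largest relation over configurations that is
barb-preserving, reduction-closed and compositional and relates only configurations with the same free
quantum variables and the same partial trace. It is the union of all such relations. -/
def ReductionBarbedCongruent {S : Signature} (K : Environment S) (C D : Config S) : Prop :=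
  ∃ R : Config S → Config S → Prop,
    OnConfigs R ∧ BarbPreserving K R ∧ ReductionClosed K R ∧ Compositional R ∧ SameEnv R ∧ R C D

end QCCS

/-! Let `R` witness reduction barbed congruence. It suffices that `R`, up to inert components `‖ 0`,
is an open bisimulation. Equality of free variables and partial traces is part of the definition of
`R`, closure under super-operators replaces a related pair by the pair `E(C)`, `E(D)`, and internal
moves are matched by reduction closedness. What remains is to match a visible action `α` of `C`.

For this, both sides are put in parallel with a test `T` that can synchronise with `α` and then
releases a fresh quantum variable `s`. The signal of success is the disappearance of `s` from the
free quantum variables, on which related configurations agree. Quantum variables serve this purpose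
better than channels: there are infinitely many of them and a process has finitely many free ones,
while a channel outside those of the processes need not exist. If `C ‖ T` reaches `C' ‖ 0`, then `D
‖ T` reaches a distribution all of whose members are related to `C' ‖ 0`; in each of them the test
must have succeeded, and the run of `D ‖ T` can be decomposed into a weak `α` transition of `D`
(`IsTest.weak`, `IsReductionCongruence.match_of_test`).

Inputs and classical outputs need one such test each. Quantum output needs two stages with two fresh
variables, because a received variable cannot be compared with `r` by a boolean guard; its identity
is read off from the free variables before and after its release
(`IsReductionCongruence.match_qout`).

The tests leave a component `0` behind, and `R` need not be closed under its removal. Hence the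
bisimulation is `PadRel R`, which relates `C` and `D` if `R` relates them after adding the same
number of components `0`.

The probabilistic bookkeeping rests on `Lift.exists_kernel`, which splits a lifted transition over
the states of its source, and on `WeakTau.induction_of_pure`, which turns this into an induction
principle for weak transitions. -/

namespace QCCS


/-! ## Finitely supported distributions and the lifting -/

section Lifting
variable {X Y : Type}

theorem PMF.bind_congr_support {A B : Type} (p : PMF A) {f g : A → PMF B}
    (h : ∀ a ∈ p.support, f a = g a) : p.bind f = p.bind g := by
  ext b
  simp only [PMF.bind_apply]
  refine tsum_congr fun a => ?_
  by_cases ha : p a = 0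
  · simp [ha]
  · rw [h a ((p.mem_support_iff a).2 ha)]

theorem PMF.map_congr_support {A B : Type} (p : PMF A) {f g : A → B}
    (h : ∀ a ∈ p.support, f a = g a) : p.map f = p.map g :=
  PMF.bind_congr_support p fun a ha => by simp [h a ha]

theorem PMF.support_bind_subset {A B : Type} (p : PMF A) (f : A → PMF B) {a : A} (ha : p a ≠ 0) :
    (f a).support ⊆ (p.bind f).support := fun b hb =>
  (PMF.mem_support_bind_iff p f b).2 ⟨a, (p.mem_support_iff a).2 ha, hb⟩

theorem PMF.finite_support_bind {A B : Type} {p : PMF A} {f : A → PMF B}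
    (hp : p.support.Finite) (hf : ∀ a ∈ p.support, (f a).support.Finite) :
    (p.bind f).support.Finite := by
  rw [PMF.support_bind]
  exact hp.biUnion hf

theorem PMF.finite_support_map {A B : Type} {p : PMF A} (f : A → B) (hp : p.support.Finite) :
    (p.map f).support.Finite := by
  rw [PMF.support_map]
  exact hp.image f

/-- A finitely supported distribution is a finite convex combination of points of its support. -/
theorem PMF.exists_fin_map {A : Type} (q : PMF A) (hq : q.support.Finite) :
    ∃ (n : ℕ) (p : PMF (Fin n)) (k : Fin n → A), p.map k = q ∧ ∀ i, k i ∈ q.support := by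
  classical
  have : Finite q.support := hq
  obtain ⟨n, ⟨e⟩⟩ := Finite.exists_equiv_fin q.support
  obtain ⟨a₀, h₀⟩ := q.support_nonempty
  -- The value outside the support is arbitrary, since `q` gives it no weight.
  let idx : A → Fin n := fun a => if h : a ∈ q.support then e ⟨a, h⟩ else e ⟨a₀, h₀⟩
  refine ⟨n, q.map idx, fun i => (e.symm i).1, ?_, fun i => (e.symm i).2⟩
  rw [PMF.map_comp]
  refine (PMF.map_congr_support q (g := id) fun a ha => ?_).trans (PMF.map_id q)
  have : idx a = e ⟨a, ha⟩ := dif_pos ha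
  simp [this]

variable {R : X → PMF X → Prop}

/-- An index of weight zero contributes nothing to either mixture, so it may borrow the pair of some
index of positive weight. -/
theorem Lift.linear_of_ne_zero {n : ℕ} (p : PMF (Fin n)) (Δ Θ : Fin n → PMF X)
    (h : ∀ i, p i ≠ 0 → Lift R (Δ i) (Θ i)) : Lift R (p.bind Δ) (p.bind Θ) := by
  classical
  obtain ⟨j, hj⟩ := p.support_nonempty
  have hj' : p j ≠ 0 := (p.mem_support_iff j).1 hj
  have key : ∀ F : Fin n → PMF X, p.bind F = p.bind fun i => if p i = 0 then F j else F i :=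
    fun F => PMF.bind_congr_support p fun a ha => by rw [if_neg ((p.mem_support_iff a).1 ha)]
  rw [key Δ, key Θ]
  refine Lift.linear p _ _ fun i => ?_
  by_cases hi : p i = 0
  · simpa [hi] using h j hj'
  · simpa [hi] using h i hi

/-- The lifting admits finite convex combinations only. Finite support allows the index set to be
replaced by some `Fin n`; this is why finiteness of supports is tracked throughout. -/
theorem Lift.bind {A : Type} {q : PMF A} (hq : q.support.Finite) {Δ Θ : A → PMF X}
    (h : ∀ a ∈ q.support, Lift R (Δ a) (Θ a)) : Lift R (q.bind Δ) (q.bind Θ) := by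
  obtain ⟨n, p, k, rfl, hk⟩ := PMF.exists_fin_map q hq
  rw [PMF.bind_map, PMF.bind_map]
  exact Lift.linear p _ _ fun i => h _ (hk i)

theorem Lift.finite_right (hR : ∀ s Θ, R s Θ → Θ.support.Finite) {Δ Θ : PMF X}
    (h : Lift R Δ Θ) : Θ.support.Finite := by
  induction h with
  | point h => exact hR _ _ h
  | linear p Δ Θ _ ih => exact PMF.finite_support_bind (Set.toFinite _) fun i _ => ih i

/-- Membership in `P` is preserved by the lifting of a relation that preserves it. -/
theorem Lift.support_right {P : X → Prop}
    (hR : ∀ s Θ, P s → R s Θ → ∀ t ∈ Θ.support, P t) {Δ Θ : PMF X} (h : Lift R Δ Θ)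
    (hΔ : ∀ s ∈ Δ.support, P s) : ∀ t ∈ Θ.support, P t := by
  induction h with
  | point h => exact hR _ _ (hΔ _ (by simp)) h
  | linear p Δ Θ _ ih =>
    intro t ht
    obtain ⟨i, hi, hit⟩ := (PMF.mem_support_bind_iff _ _ _).1 ht
    exact ih i (fun s hs => hΔ s (PMF.support_bind_subset p Δ hi hs)) t hit

/-- Transport of a lifting along a function, for a relation that is respected on `P`. -/
theorem Lift.map {R' : Y → PMF Y → Prop} {P : X → Prop} {f : X → Y}
    (hR : ∀ s Θ, P s → R s Θ → R' (f s) (Θ.map f)) {Δ Θ : PMF X} (h : Lift R Δ Θ)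
    (hΔ : ∀ s ∈ Δ.support, P s) : Lift R' (Δ.map f) (Θ.map f) := by
  induction h with
  | point h =>
    rw [PMF.pure_map]
    exact .point (hR _ _ (hΔ _ (by simp)) h)
  | linear p Δ Θ _ ih =>
    rw [PMF.map_bind, PMF.map_bind]
    exact Lift.linear_of_ne_zero p _ _ fun i hi =>
      ih i fun s hs => hΔ s (PMF.support_bind_subset p Δ hi hs)

/-- Every lifted pair comes from a choice of targets for the single states. -/
theorem Lift.exists_kernel {Δ Θ : PMF X} (h : Lift R Δ Θ) :
    ∃ f : X → PMF X, Θ = Δ.bind f ∧ ∀ s ∈ Δ.support, Lift R (PMF.pure s) (f s) := by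
  classical
  induction h with
  | @point s Θ h =>
    refine ⟨fun _ => Θ, by simp, fun t ht => ?_⟩
    rw [PMF.mem_support_pure_iff] at ht
    exact ht ▸ .point h
  | @linear n p Δ Θ _ ih =>
    choose f hf hL using ih
    have hD : ∀ s, ∑' i, p i * Δ i s = p.bind Δ s := fun s => (PMF.bind_apply p Δ s).symm
    have htop : ∀ s, ∑' i, p i * Δ i s ≠ ∞ := fun s => hD s ▸ PMF.apply_ne_top _ _
    -- Bayes' rule: given that the mixture of the `Δ i` produced `s`, the index `i` has probability
    -- proportional to `p i * Δ i s`, and the target for `s` mixes the `f i s` with these weights.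
    -- The value off the support is a dummy.
    refine ⟨fun s => if h0 : ∑' i, p i * Δ i s ≠ 0 then
      (PMF.normalize (fun i => p i * Δ i s) h0 (htop s)).bind fun i => f i s else PMF.pure s,
      ?_, fun s hs => ?_⟩
    · ext y
      simp only [PMF.bind_apply]
      have h1 : ∀ i, p i * Θ i y = ∑' s, p i * Δ i s * f i s y := fun i => by
        rw [hf i, PMF.bind_apply, ← ENNReal.tsum_mul_left]
        exact tsum_congr fun s => (mul_assoc _ _ _).symm
      rw [tsum_congr h1, ENNReal.tsum_comm]
      refine tsum_congr fun s => ?_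
      by_cases h0 : ∑' i, p i * Δ i s ≠ 0
      · rw [dif_pos h0, PMF.bind_apply, ← ENNReal.tsum_mul_left]
        refine tsum_congr fun i => ?_
        rw [PMF.normalize_apply]
        calc p i * Δ i s * f i s y
            = ((∑' i, p i * Δ i s) * (∑' i, p i * Δ i s)⁻¹) * (p i * Δ i s * f i s y) := by
              rw [ENNReal.mul_inv_cancel h0 (htop s), one_mul]
          _ = _ := by ring
      · rw [not_not] at h0
        rw [ENNReal.tsum_eq_zero.2 fun i => by rw [ENNReal.tsum_eq_zero.1 h0 i, zero_mul]]
        exact (mul_eq_zero_of_left h0 _).symm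
    · have h0 : ∑' i, p i * Δ i s ≠ 0 := by
        rw [hD]
        exact (PMF.mem_support_iff _ _).1 hs
      simp only [dif_pos h0]
      rw [← PMF.bind_const (PMF.normalize (fun i => p i * Δ i s) h0 (htop s)) (PMF.pure s)]
      refine Lift.linear_of_ne_zero _ _ _ fun i hi => hL i s ?_
      rw [PMF.mem_support_iff]
      rintro h
      exact hi (by simp [PMF.normalize_apply, h])

end Lifting

/-! ### Lifted relations between states -/

/-- If a mixture is a point distribution, all its components of positive weight are that same point.
The induction therefore runs over all `Δ` whose support lies in `{s}`. -/
theorem LiftRel.rel_of_pure {X : Type} {R : X → X → Prop} {s : X} {Θ : PMF X}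
    (h : LiftRel R (PMF.pure s) Θ) : ∀ t ∈ Θ.support, R s t := by
  have key : ∀ {Δ Θ : PMF X}, LiftRel R Δ Θ → (∀ s' ∈ Δ.support, s' = s) →
      ∀ t ∈ Θ.support, R s t := by
    intro Δ Θ h
    induction h with
    | point h =>
      obtain ⟨t, ht, rfl⟩ := h
      intro hs t' ht'
      rw [PMF.mem_support_pure_iff] at ht'
      rw [ht', ← hs _ ((PMF.mem_support_pure_iff _ _).2 rfl)]
      exact ht
    | linear p Δ Θ _ ih =>
      intro hs t ht
      obtain ⟨i, hi, hit⟩ := (PMF.mem_support_bind_iff _ _ _).1 ht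
      exact ih i (fun s' hs' => hs s' (PMF.support_bind_subset p Δ hi hs')) t hit
  exact key h (by simp)

/-- The point distribution is written as the constant mixture of itself with the weights of `Θ`. -/
theorem LiftRel.of_pure {X : Type} {R : X → X → Prop} {s : X} {Θ : PMF X}
    (hΘ : Θ.support.Finite) (h : ∀ t ∈ Θ.support, R s t) : LiftRel R (PMF.pure s) Θ := by
  have := Lift.bind (R := fun s Θ => ∃ t, R s t ∧ Θ = PMF.pure t) hΘ (Δ := fun _ => PMF.pure s)
    (Θ := PMF.pure) fun t ht => .point ⟨t, h t ht, rfl⟩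
  rwa [PMF.bind_const, PMF.bind_pure] at this

theorem LiftRel.map {X Y : Type} {R : X → X → Prop} {R' : Y → Y → Prop} {P Q : X → Prop}
    {f : X → Y} (hR : ∀ s t, P s → Q t → R s t → R' (f s) (f t)) {Δ Θ : PMF X}
    (h : LiftRel R Δ Θ) (hΔ : ∀ s ∈ Δ.support, P s) (hΘ : ∀ t ∈ Θ.support, Q t) :
    LiftRel R' (Δ.map f) (Θ.map f) := by
  unfold LiftRel at h
  induction h with
  | point h =>
    obtain ⟨t, ht, rfl⟩ := h
    rw [PMF.pure_map, PMF.pure_map]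
    exact .point ⟨_, hR _ _ (hΔ _ ((PMF.mem_support_pure_iff _ _).2 rfl))
      (hΘ _ ((PMF.mem_support_pure_iff _ _).2 rfl)) ht, rfl⟩
  | linear p Δ Θ _ ih =>
    rw [PMF.map_bind, PMF.map_bind]
    exact Lift.linear_of_ne_zero p _ _ fun i hi =>
      ih i (fun s hs => hΔ s (PMF.support_bind_subset p Δ hi hs))
        fun s hs => hΘ s (PMF.support_bind_subset p Θ hi hs)

theorem LiftRel.flip {X : Type} {R : X → X → Prop} {Δ Θ : PMF X} (h : LiftRel R Δ Θ) :
    LiftRel (fun a b => R b a) Θ Δ := by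
  unfold LiftRel at h
  induction h with
  | @point s Θ h =>
    obtain ⟨t, ht, rfl⟩ := h
    exact .point ⟨s, ht, rfl⟩
  | linear p Δ Θ _ ih => exact .linear p _ _ ih

variable {S : Signature}

/-! ## Free quantum variables under substitution -/

section Membership
variable {N : Type} {m n : ℕ} (P Q : Proc S N m n) (a : QRef N n)

theorem Proc.mem_qv_sum' : a ∈ (Proc.sum P Q).qv ↔ a ∈ P.qv ∨ a ∈ Q.qv := by simp [Proc.qv]

theorem Proc.mem_qv_par' : a ∈ (Proc.par P Q).qv ↔ a ∈ P.qv ∨ a ∈ Q.qv := by simp [Proc.qv]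

theorem Proc.mem_qv_qout' (c : S.QChan) (q : QRef N n) :
    a ∈ (Proc.qout c q P).qv ↔ a = q ∨ a ∈ P.qv := by simp [Proc.qv]

theorem Proc.mem_qv_oper' {k : ℕ} (E : SuperOp (Fin k)) (q : Fin k → QRef N n) :
    a ∈ (Proc.oper E q P).qv ↔ a ∈ P.qv ∨ ∃ i, q i = a := by simp [Proc.qv]

theorem Proc.mem_qv_meas' {k : ℕ} (M : Measurement k) (q : Fin k → QRef N n)
    (P : Proc S N (m + 1) n) : a ∈ (Proc.meas M q P).qv ↔ a ∈ P.qv ∨ ∃ i, q i = a := by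
  simp [Proc.qv]

theorem Proc.mem_qv_const' (A : S.Const) (q : Fin (S.qArity A) → QRef N n)
    (x : Fin (S.cArity A) → Fin m ⊕ ℝ) :
    a ∈ (Proc.const A q x : Proc S N m n).qv ↔ ∃ i, q i = a := by simp [Proc.qv]

end Membership

/-- The quantum variable `a` is free in `P`. -/
def Proc.Has (P : CProc S) (a : QVar) : Prop := a ∈ P.qv

section ClosedMembership
variable (P Q : CProc S) (a : QVar)

theorem Proc.has_sum : (Proc.sum P Q : CProc S).Has a ↔ P.Has a ∨ Q.Has a :=
  Proc.mem_qv_sum' P Q a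

theorem Proc.has_par : (Proc.par P Q : CProc S).Has a ↔ P.Has a ∨ Q.Has a :=
  Proc.mem_qv_par' P Q a

theorem Proc.has_qout (c : S.QChan) (q : QVar) :
    (Proc.qout c q P : CProc S).Has a ↔ a = q ∨ P.Has a :=
  Proc.mem_qv_qout' P a c q

theorem Proc.has_oper {k : ℕ} (E : SuperOp (Fin k)) (q : Fin k → QVar) :
    (Proc.oper E q P : CProc S).Has a ↔ P.Has a ∨ ∃ i, q i = a :=
  Proc.mem_qv_oper' P a E q

theorem Proc.has_meas {k : ℕ} (M : Measurement k) (q : Fin k → QVar) (P : Proc S QVar 1 0) :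
    (Proc.meas M q P : CProc S).Has a ↔ a ∈ P.qv ∨ ∃ i, q i = a :=
  Proc.mem_qv_meas' (n := 0) a M q P

theorem Proc.has_const (A : S.Const) (q : Fin (S.qArity A) → QVar)
    (x : Fin (S.cArity A) → Fin 0 ⊕ ℝ) :
    (Proc.const A q x : CProc S).Has a ↔ ∃ i, q i = a :=
  Proc.mem_qv_const' (n := 0) a A q x

theorem Proc.not_has_nil : ¬ (Proc.nil : CProc S).Has a :=
  Finset.notMem_empty a

end ClosedMembership

theorem Proc.qv_csubst {N : Type} {m n : ℕ} (P : Proc S N m n) :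
    ∀ {m' : ℕ} (σ : Fin m → Fin m' ⊕ ℝ), (P.csubst σ).qv = P.qv := by
  induction P <;> intro m' σ <;> simp_all [Proc.csubst, Proc.qv]

open Classical in
theorem Proc.qv_qsubst {N N' : Type} {m n : ℕ} (P : Proc S N m n) :
    ∀ {n' : ℕ} (σ : QRef N n → QRef N' n'), (P.qsubst σ).qv = P.qv.image σ := by
  induction P with
  | @qin m n c P ih =>
    intro n' σ
    have h := ih (n' := n' + 1) (Option.map σ)
    ext r
    simp only [Proc.qsubst, Proc.qv, Finset.mem_eraseNone, Finset.mem_image]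
    rw [h]
    simp only [Finset.mem_image]
    constructor
    · rintro ⟨a, ha, hr⟩
      obtain ⟨b, rfl, rfl⟩ := Option.map_eq_some_iff.1 hr
      exact ⟨b, ha, rfl⟩
    · rintro ⟨b, hb, rfl⟩
      exact ⟨some b, hb, rfl⟩
  | nil => intro n' σ; simp [Proc.qsubst, Proc.qv]
  | tau P ih | cin c P ih | cout c e P ih | relabel P f g ih | restrict P L ih | ite b P ih =>
    intro n' σ; exact ih σ
  | qout c q P ih => intro n' σ; simp [Proc.qsubst, Proc.qv, ih, Finset.image_insert]
  | oper E q P ih | meas E q P ih =>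
    intro n' σ
    simp [Proc.qsubst, Proc.qv, ih, Finset.image_union, Finset.image_image]
  | sum P Q ihP ihQ | par P Q ihP ihQ =>
    intro n' σ; simp [Proc.qsubst, Proc.qv, ihP, ihQ, Finset.image_union]
  | const A q x => intro n' σ; simp [Proc.qsubst, Proc.qv, Finset.image_image]

theorem Proc.has_instC (P : Proc S QVar 1 0) (v : ℝ) (a : QVar) :
    (P.instC v).Has a ↔ a ∈ P.qv := by
  unfold Proc.Has Proc.instC
  rw [Proc.qv_csubst]

open Classical in
theorem Proc.mem_qv_qsubst {N N' : Type} {m n n' : ℕ} (P : Proc S N m n)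
    (σ : QRef N n → QRef N' n') (a : QRef N' n') :
    a ∈ (P.qsubst σ).qv ↔ ∃ b ∈ P.qv, σ b = a := by
  rw [P.qv_qsubst, Finset.mem_image]

theorem Proc.has_of_has_instQ (c : S.QChan) (P : Proc S QVar 0 1) (r a : QVar)
    (ha : (P.instQ r).Has a) : (Proc.qin c P : CProc S).Has a ∨ a = r := by
  obtain ⟨b, hb, rfl⟩ := (P.mem_qv_qsubst _ _).1 ha
  cases b with
  | none => exact .inr rfl
  | some b => exact .inl (Finset.mem_eraseNone.2 hb)

theorem Environment.has_of_has_unfold (K : Environment S) (A : S.Const)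
    (q : Fin (S.qArity A) → QVar) (v : Fin (S.cArity A) → ℝ)
    (x : Fin (S.cArity A) → Fin 0 ⊕ ℝ) (a : QVar) (ha : (K.unfold A q v).Has a) :
    (Proc.const A q x : CProc S).Has a := by
  unfold Environment.unfold Proc.Has at ha
  rw [Proc.qv_csubst] at ha
  obtain ⟨b, -, rfl⟩ := (Proc.mem_qv_qsubst _ _ _).1 ha
  exact (Proc.has_const _ _ _ _).2 ⟨b, rfl⟩

/-! ## Transitions -/

variable {K : Environment S}

/-- Only measurements branch, and they have finitely many outcomes. -/
theorem Step.finite_support {C : Config S} {α : Act S} {Δ : PMF (Config S)} (h : Step K C α Δ) :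
    Δ.support.Finite := by
  induction h with
  | meas M e P ρ p σ hp hσ => exact PMF.finite_support_map _ (Set.toFinite _)
  | intL _ _ ih | intR _ _ ih | rel _ _ _ ih | res _ _ _ ih => exact PMF.finite_support_map _ ih
  | sumL _ ih | sumR _ ih | cho _ _ _ ih | cons _ _ _ _ ih => exact ih
  | _ => simp

/-- A visible action leads to a single configuration, and does not change the state. -/
theorem Step.eq_pure {C : Config S} {α : Act S} {Δ : PMF (Config S)} (h : Step K C α Δ)
    (hα : α ≠ .tau) : ∃ P, Δ = PMF.pure ⟨P, C.state⟩ := by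
  induction h with
  | tau | cComL | cComR | qComL | qComR | oper | meas => exact absurd rfl hα
  | cInp | cOutp | qInp | qOutp => exact ⟨_, rfl⟩
  | intL _ _ ih | intR _ _ ih | res _ _ _ ih =>
    obtain ⟨P, rfl⟩ := ih hα
    exact ⟨_, PMF.pure_map _ _⟩
  | @rel P ρ α Δ f g _ ih =>
    obtain ⟨P, rfl⟩ := ih (by rintro rfl; exact hα rfl)
    exact ⟨_, PMF.pure_map _ _⟩
  | sumL _ ih | sumR _ ih | cho _ _ _ ih | cons _ _ _ _ ih => exact ih hα

/-- The quantum variable that is sent by an action. -/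
def Act.sent : Act S → Finset QVar
  | .qout _ r => {r}
  | _ => ∅

theorem Act.sent_relabel (f : S.CChan → S.CChan) (g : S.QChan → S.QChan) (α : Act S) :
    (α.relabel f g).sent = α.sent := by cases α <;> rfl

theorem Act.qbv_relabel (f : S.CChan → S.CChan) (g : S.QChan → S.QChan) (α : Act S) :
    (α.relabel f g).qbv = α.qbv := by cases α <;> rfl

/-- This ensures that communication inside a process does not enlarge its set of free variables:
what one component receives was already free in the other. -/
theorem Step.has_of_mem_sent {C : Config S} {α : Act S} {Δ : PMF (Config S)}
    (h : Step K C α Δ) : ∀ a : QVar, a ∈ α.sent → C.proc.Has a := by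
  induction h with
  | qOutp => simpa [Act.sent] using (Proc.has_qout _ _ _ _).2 (.inl rfl)
  | intL _ _ ih => exact fun a ha => (Proc.has_par _ _ _).2 (.inl (ih a ha))
  | sumL _ ih => exact fun a ha => (Proc.has_sum _ _ _).2 (.inl (ih a ha))
  | intR _ _ ih => exact fun a ha => (Proc.has_par _ _ _).2 (.inr (ih a ha))
  | sumR _ ih => exact fun a ha => (Proc.has_sum _ _ _).2 (.inr (ih a ha))
  | rel f g _ ih => rw [Act.sent_relabel]; exact ih
  | res _ _ _ ih | cho _ _ _ ih => exact ih
  | cons A q x _ ih => exact fun a ha => K.has_of_has_unfold A q _ x a (ih a ha)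
  | _ => simp [Act.sent]

/-- A process can only acquire quantum variables by receiving them. -/
theorem Step.has {C : Config S} {α : Act S} {Δ : PMF (Config S)} (h : Step K C α Δ) :
    ∀ C' ∈ Δ.support, ∀ a : QVar, C'.proc.Has a → C.proc.Has a ∨ a ∈ α.qbv := by
  induction h with
  | tau | cOutp =>
    simp only [PMF.mem_support_pure_iff, forall_eq]
    exact fun a ha => .inl ha
  | qOutp =>
    simp only [PMF.mem_support_pure_iff, forall_eq]
    exact fun a ha => .inl ((Proc.has_qout _ _ _ _).2 (.inr ha))
  | cInp c P ρ v =>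
    simp only [PMF.mem_support_pure_iff, forall_eq, Proc.has_instC]
    exact fun a ha => .inl ha
  | qInp c P ρ r hr =>
    simp only [PMF.mem_support_pure_iff, forall_eq, Act.qbv, Finset.mem_singleton]
    exact fun a ha => P.has_of_has_instQ c r a ha
  | oper =>
    simp only [PMF.mem_support_pure_iff, forall_eq]
    exact fun a ha => .inl ((Proc.has_oper _ _ _ _).2 (.inl ha))
  | meas M e P ρ p σ hp hσ =>
    intro C' hC' a ha
    obtain ⟨i, -, rfl⟩ := (PMF.mem_support_map_iff _ _ _).1 hC'
    rw [Proc.has_instC] at ha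
    exact .inl ((Proc.has_meas _ _ _ _).2 (.inl ha))
  | cComL _ _ ih₁ ih₂ | cComR _ _ ih₁ ih₂ =>
    simp only [PMF.mem_support_pure_iff, forall_eq, Act.qbv, Finset.notMem_empty, or_false,
      Proc.has_par] at ih₁ ih₂ ⊢
    exact fun a ha => ha.imp (ih₁ a) (ih₂ a)
  | qComL _ h₂ ih₁ ih₂ =>
    have s₂ := h₂.has_of_mem_sent
    simp only [PMF.mem_support_pure_iff, forall_eq, Act.qbv, Act.sent, Finset.notMem_empty,
      Finset.mem_singleton, or_false, Proc.has_par] at ih₁ ih₂ s₂ ⊢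
    exact fun a ha => ha.elim (fun ha =>
      (ih₁ a ha).imp_right fun h => by rwa [h]) fun ha => .inr (ih₂ a ha)
  | qComR h₁ _ ih₁ ih₂ =>
    have s₁ := h₁.has_of_mem_sent
    simp only [PMF.mem_support_pure_iff, forall_eq, Act.qbv, Act.sent, Finset.notMem_empty,
      Finset.mem_singleton, or_false, Proc.has_par] at ih₁ ih₂ s₁ ⊢
    exact fun a ha => ha.elim (fun ha => .inl (ih₁ a ha)) fun ha =>
      (ih₂ a ha).elim .inr fun h => .inl (by rwa [h])
  | intL _ _ ih | intR _ _ ih =>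
    intro C' hC' a ha
    obtain ⟨D, hD, rfl⟩ := (PMF.mem_support_map_iff _ _ _).1 hC'
    have := ih D hD a
    simp only [Proc.has_par] at ha ⊢
    tauto
  | sumL _ ih | sumR _ ih =>
    intro C' hC' a ha
    have := ih C' hC' a ha
    simp only [Proc.has_sum] at ha ⊢
    tauto
  | rel f g _ ih =>
    rw [Act.qbv_relabel]
    intro C' hC'
    obtain ⟨D, hD, rfl⟩ := (PMF.mem_support_map_iff _ _ _).1 hC'
    exact ih D hD
  | res _ _ _ ih =>
    intro C' hC'
    obtain ⟨D, hD, rfl⟩ := (PMF.mem_support_map_iff _ _ _).1 hC'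
    exact ih D hD
  | cho _ _ _ ih => exact ih
  | cons A q x _ ih =>
    exact fun C' hC' a ha => (ih C' hC' a ha).imp_left (K.has_of_has_unfold A q _ x a)

/-- Complementary actions. -/
inductive Co : Act S → Act S → Prop
  | cin (c : S.CChan) (v : ℝ) : Co (.cin c v) (.cout c v)
  | cout (c : S.CChan) (v : ℝ) : Co (.cout c v) (.cin c v)
  | qin (c : S.QChan) (r : QVar) : Co (.qin c r) (.qout c r)
  | qout (c : S.QChan) (r : QVar) : Co (.qout c r) (.qin c r)

/-- The four communication rules are merged through `Co`, so that classical and quantum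
synchronisation can be treated alike. -/
theorem Step.par_tau {P Q : CProc S} {ρ : Density QVar} {Δ : PMF (Config S)}
    (h : Step K ⟨.par P Q, ρ⟩ .tau Δ) :
    (∃ Δ₀, Step K ⟨P, ρ⟩ .tau Δ₀ ∧ Δ = Δ₀.map fun C => C.par Q) ∨
    (∃ Δ₀, Step K ⟨Q, ρ⟩ .tau Δ₀ ∧ Δ = Δ₀.map fun C => ⟨.par P C.proc, C.state⟩) ∨
    ∃ α β P' Q', Co α β ∧ Step K ⟨P, ρ⟩ α (PMF.pure ⟨P', ρ⟩) ∧
      Step K ⟨Q, ρ⟩ β (PMF.pure ⟨Q', ρ⟩) ∧ Δ = PMF.pure ⟨.par P' Q', ρ⟩ := by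
  cases h with
  | intL h _ => exact .inl ⟨_, h, rfl⟩
  | intR h _ => exact .inr (.inl ⟨_, h, rfl⟩)
  | cComL h₁ h₂ => exact .inr (.inr ⟨_, _, _, _, .cin _ _, h₁, h₂, rfl⟩)
  | cComR h₁ h₂ => exact .inr (.inr ⟨_, _, _, _, .cout _ _, h₁, h₂, rfl⟩)
  | qComL h₁ h₂ => exact .inr (.inr ⟨_, _, _, _, .qin _ _, h₁, h₂, rfl⟩)
  | qComR h₁ h₂ => exact .inr (.inr ⟨_, _, _, _, .qout _ _, h₁, h₂, rfl⟩)

theorem Step.sync {P Q P' Q' : CProc S} {ρ : Density QVar} {α β : Act S} (hc : Co α β)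
    (h₁ : Step K ⟨P, ρ⟩ α (PMF.pure ⟨P', ρ⟩)) (h₂ : Step K ⟨Q, ρ⟩ β (PMF.pure ⟨Q', ρ⟩)) :
    Step K ⟨.par P Q, ρ⟩ .tau (PMF.pure ⟨.par P' Q', ρ⟩) := by
  cases hc with
  | cin => exact .cComL h₁ h₂
  | cout => exact .cComR h₁ h₂
  | qin => exact .qComL h₁ h₂
  | qout => exact .qComR h₁ h₂

theorem Step.not_nil {ρ : Density QVar} {α : Act S} {Δ : PMF (Config S)} :
    ¬ Step K ⟨.nil, ρ⟩ α Δ := by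
  intro h; cases h

theorem Step.par_nil {P : CProc S} {ρ : Density QVar} {α : Act S} {Δ : PMF (Config S)}
    (h : Step K ⟨.par P .nil, ρ⟩ α Δ) :
    ∃ Δ₀, Step K ⟨P, ρ⟩ α Δ₀ ∧ Δ = Δ₀.map fun C => C.par .nil := by
  cases h with
  | intL h _ => exact ⟨_, h, rfl⟩
  | intR h _ => cases h
  | cComL h₁ h₂ => cases h₂
  | cComR h₁ h₂ => cases h₂
  | qComL h₁ h₂ => cases h₂
  | qComR h₁ h₂ => cases h₂

/-! ### Inversion of the rules for single operators -/

theorem Step.tau_inv {P : CProc S} {ρ : Density QVar} {α : Act S} {Δ : PMF (Config S)}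
    (h : Step K ⟨.tau P, ρ⟩ α Δ) : α = .tau ∧ Δ = PMF.pure ⟨P, ρ⟩ := by
  cases h; exact ⟨rfl, rfl⟩

theorem Step.cin_inv {c : S.CChan} {P : Proc S QVar 1 0} {ρ : Density QVar} {α : Act S}
    {Δ : PMF (Config S)} (h : Step K ⟨.cin c P, ρ⟩ α Δ) :
    ∃ v, α = .cin c v ∧ Δ = PMF.pure ⟨P.instC v, ρ⟩ := by
  cases h; exact ⟨_, rfl, rfl⟩

theorem Step.cout_inv {c : S.CChan} {e : Exp S 0} {P : CProc S} {ρ : Density QVar} {α : Act S}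
    {Δ : PMF (Config S)} (h : Step K ⟨.cout c e P, ρ⟩ α Δ) :
    α = .cout c (e.eval Fin.elim0) ∧ Δ = PMF.pure ⟨P, ρ⟩ := by
  cases h; exact ⟨rfl, rfl⟩

theorem Step.qin_inv {c : S.QChan} {P : Proc S QVar 0 1} {ρ : Density QVar} {α : Act S}
    {Δ : PMF (Config S)} (h : Step K ⟨.qin c P, ρ⟩ α Δ) :
    ∃ r, r ∉ (Proc.qin c P : CProc S).qv ∧ α = .qin c r ∧ Δ = PMF.pure ⟨P.instQ r, ρ⟩ := by
  cases h with
  | qInp _ _ _ r hr => exact ⟨r, hr, rfl, rfl⟩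

theorem Step.qout_inv {c : S.QChan} {q : QVar} {P : CProc S} {ρ : Density QVar} {α : Act S}
    {Δ : PMF (Config S)} (h : Step K ⟨.qout c q P, ρ⟩ α Δ) :
    α = .qout c q ∧ Δ = PMF.pure ⟨P, ρ⟩ := by
  cases h; exact ⟨rfl, rfl⟩

theorem Step.sum_inv {P Q : CProc S} {ρ : Density QVar} {α : Act S} {Δ : PMF (Config S)}
    (h : Step K ⟨.sum P Q, ρ⟩ α Δ) : Step K ⟨P, ρ⟩ α Δ ∨ Step K ⟨Q, ρ⟩ α Δ := by
  cases h with
  | sumL h => exact .inl h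
  | sumR h => exact .inr h

theorem Step.ite_inv {b : BExp S 0} {P : CProc S} {ρ : Density QVar} {α : Act S}
    {Δ : PMF (Config S)} (h : Step K ⟨.ite b P, ρ⟩ α Δ) :
    Step K ⟨P, ρ⟩ α Δ ∧ b.eval Fin.elim0 := by
  cases h with
  | cho b h hb => exact ⟨h, hb⟩

/-! ## Weak transitions -/

theorem Trans.of_tau {C : Config S} {Δ : PMF (Config S)} (h : Step K C .tau Δ) :
    Trans K .tau C Δ := ⟨h, Finset.disjoint_empty_left _⟩

theorem TauHat.finite {C : Config S} {Δ : PMF (Config S)} (h : TauHat K C Δ) :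
    Δ.support.Finite := by
  rcases h with h | rfl
  · exact h.1.finite_support
  · simp

theorem lift_tauHat_refl {Δ : PMF (Config S)} (h : Δ.support.Finite) :
    Lift (TauHat K) Δ Δ := by
  have := Lift.bind (R := TauHat K) h (Δ := PMF.pure) (Θ := PMF.pure)
    fun a _ => .point (.inr rfl)
  rwa [PMF.bind_pure] at this

theorem WeakTau.of_step {C : Config S} {Δ : PMF (Config S)} (h : Step K C .tau Δ) :
    WeakTau K (PMF.pure C) Δ := .single (.point (.inl (.of_tau h)))

theorem WeakTau.finite {Δ Θ : PMF (Config S)} (h : WeakTau K Δ Θ) (hΔ : Δ.support.Finite) :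
    Θ.support.Finite := by
  induction h with
  | refl => exact hΔ
  | tail _ h _ => exact h.finite_right fun _ _ => TauHat.finite

theorem WeakTau.support {P : Config S → Prop}
    (hP : ∀ C Δ, P C → Step K C .tau Δ → ∀ D ∈ Δ.support, P D) {Δ Θ : PMF (Config S)}
    (h : WeakTau K Δ Θ) (hΔ : ∀ C ∈ Δ.support, P C) : ∀ D ∈ Θ.support, P D := by
  induction h with
  | refl => exact hΔ
  | tail _ h ih =>
    refine h.support_right ?_ ih
    rintro C Θ hC (h | rfl)
    · exact hP C Θ hC h.1
    · intro t ht
      rw [PMF.mem_support_pure_iff] at ht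
      rwa [ht]

/-- The components may need different numbers of steps. They are advanced one after the other, and
the waiting ones use the idle steps that `TauHat` allows. -/
theorem WeakTau.linear {n : ℕ} (p : PMF (Fin n)) {Δ Θ : Fin n → PMF (Config S)}
    (hΔ : ∀ i, (Δ i).support.Finite) (h : ∀ i, WeakTau K (Δ i) (Θ i)) :
    WeakTau K (p.bind Δ) (p.bind Θ) := by
  classical
  have one : ∀ (F : Fin n → PMF (Config S)) (i : Fin n), (∀ j, (F j).support.Finite) →
      ∀ Ξ, WeakTau K (F i) Ξ → WeakTau K (p.bind F) (p.bind (Function.update F i Ξ)) := by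
    intro F i hF Ξ hΞ
    induction hΞ with
    | refl => rw [Function.update_eq_self]; exact .refl
    | @tail Ξ Ξ' h₁ h₂ ih =>
      refine ih.tail (.linear p _ _ fun j => ?_)
      by_cases hj : j = i
      · subst hj; simpa using h₂
      · simpa [hj] using lift_tauHat_refl (hF j)
  have key : ∀ s : Finset (Fin n),
      WeakTau K (p.bind Δ) (p.bind fun i => if i ∈ s then Θ i else Δ i) := by
    intro s
    induction s using Finset.induction_on with
    | empty =>
      simp only [Finset.notMem_empty, if_false]
      exact .refl
    | @insert a s ha ih =>
      refine ih.trans ?_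
      have hu : (fun i => if i ∈ insert a s then Θ i else Δ i)
          = Function.update (fun i => if i ∈ s then Θ i else Δ i) a (Θ a) := by
        funext i
        by_cases hi : i = a
        · subst hi; simp
        · simp [hi]
      rw [hu]
      refine one _ a (fun j => ?_) _ (by simpa [ha] using h a)
      by_cases hj : j ∈ s
      · simpa [hj] using (h j).finite (hΔ j)
      · simpa [hj] using hΔ j
  simpa using key Finset.univ

theorem WeakTau.bind {A : Type} {q : PMF A} (hq : q.support.Finite) {Δ Θ : A → PMF (Config S)}
    (hΔ : ∀ a ∈ q.support, (Δ a).support.Finite)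
    (h : ∀ a ∈ q.support, WeakTau K (Δ a) (Θ a)) : WeakTau K (q.bind Δ) (q.bind Θ) := by
  obtain ⟨n, p, k, rfl, hk⟩ := PMF.exists_fin_map q hq
  rw [PMF.bind_map, PMF.bind_map]
  exact .linear p (fun i => hΔ _ (hk i)) fun i => h _ (hk i)

theorem weak_iff {α : Act S} (hα : α ≠ .tau) {Δ Θ : PMF (Config S)} :
    Weak K α Δ Θ ↔
      ∃ Δ' Θ', WeakTau K Δ Δ' ∧ Lift (Trans K α) Δ' Θ' ∧ WeakTau K Θ' Θ := by
  cases α with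
  | tau => exact absurd rfl hα
  | _ => exact Iff.rfl

theorem Weak.finite {α : Act S} {Δ Θ : PMF (Config S)} (h : Weak K α Δ Θ)
    (hΔ : Δ.support.Finite) : Θ.support.Finite := by
  by_cases hα : α = .tau
  · subst hα; exact WeakTau.finite h hΔ
  · obtain ⟨Δ', Θ', -, h₂, h₃⟩ := (weak_iff hα).1 h
    exact h₃.finite (h₂.finite_right fun _ _ h => h.1.finite_support)

theorem Weak.bind {α : Act S} (hα : α ≠ .tau) {A : Type} {q : PMF A} (hq : q.support.Finite)
    {Δ Θ : A → PMF (Config S)} (hΔ : ∀ a ∈ q.support, (Δ a).support.Finite)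
    (h : ∀ a ∈ q.support, Weak K α (Δ a) (Θ a)) : Weak K α (q.bind Δ) (q.bind Θ) := by
  simp only [weak_iff hα] at h ⊢
  have h' : ∀ a, ∃ Δ' Θ', a ∈ q.support →
      WeakTau K (Δ a) Δ' ∧ Lift (Trans K α) Δ' Θ' ∧ WeakTau K Θ' (Θ a) := by
    intro a
    by_cases ha : a ∈ q.support
    · obtain ⟨Δ', Θ', h⟩ := h a ha
      exact ⟨Δ', Θ', fun _ => h⟩
    · exact ⟨Δ a, Δ a, fun h => absurd h ha⟩
  choose Δ' Θ' h' using h'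
  exact ⟨q.bind Δ', q.bind Θ', .bind hq hΔ fun a ha => (h' a ha).1,
    .bind hq fun a ha => (h' a ha).2.1,
    .bind hq (fun a ha => (h' a ha).2.1.finite_right fun _ _ h => h.1.finite_support)
      fun a ha => (h' a ha).2.2⟩

theorem Weak.tail {α : Act S} (hα : α ≠ .tau) {Δ Θ Θ' : PMF (Config S)} (h : Weak K α Δ Θ)
    (h' : WeakTau K Θ Θ') : Weak K α Δ Θ' := by
  rw [weak_iff hα] at h ⊢
  obtain ⟨Δ₁, Θ₁, h₁, h₂, h₃⟩ := h
  exact ⟨Δ₁, Θ₁, h₁, h₂, h₃.trans h'⟩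

theorem Weak.head {α : Act S} (hα : α ≠ .tau) {Δ Δ' Θ : PMF (Config S)} (h : WeakTau K Δ Δ')
    (h' : Weak K α Δ' Θ) : Weak K α Δ Θ := by
  rw [weak_iff hα] at h' ⊢
  obtain ⟨Δ₁, Θ₁, h₁, h₂, h₃⟩ := h'
  exact ⟨Δ₁, Θ₁, h.trans h₁, h₂, h₃⟩

/-- Induction along the weak internal transitions of a single configuration into a set of final
configurations, the remaining transitions being split over the targets of each step. -/
theorem WeakTau.induction_of_pure {F : Config S → Prop} {G : Config S → PMF (Config S) → Prop}
    (final : ∀ X, F X → G X (PMF.pure X))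
    (step : ∀ X Δ f, Step K X .tau Δ → (∀ Y ∈ Δ.support, G Y (f Y)) → G X (Δ.bind f))
    (conv : ∀ X n (p : PMF (Fin n)) Θ, (∀ i, G X (Θ i)) → G X (p.bind Θ))
    {X : Config S} {Θ : PMF (Config S)} (h : WeakTau K (PMF.pure X) Θ)
    (hF : ∀ Z ∈ Θ.support, F Z) : G X Θ := by
  have conv' : ∀ X n (p : PMF (Fin n)) Θ, (∀ i, p i ≠ 0 → G X (Θ i)) → G X (p.bind Θ) := by
    classical
    intro X n p Θ h
    obtain ⟨j, hj⟩ := p.support_nonempty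
    have hj' : p j ≠ 0 := (p.mem_support_iff j).1 hj
    have key : p.bind Θ = p.bind fun i => if p i = 0 then Θ j else Θ i :=
      PMF.bind_congr_support p fun a ha => by rw [if_neg ((p.mem_support_iff a).1 ha)]
    rw [key]
    refine conv X n p _ fun i => ?_
    by_cases hi : p i = 0
    · simpa [hi] using h j hj'
    · simpa [hi] using h i hi
  -- A lifted step out of a point may mix several internal and idle steps of the same state `X`. The
  -- induction keeps all sources equal to `X`, and `conv'` reassembles the mixture.
  have lifted : ∀ {Δ Ξ : PMF (Config S)} (f : Config S → PMF (Config S)), Lift (TauHat K) Δ Ξ →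
      ∀ X, (∀ Y ∈ Δ.support, Y = X) → (∀ Y ∈ Ξ.support, G Y (f Y)) → G X (Ξ.bind f) := by
    intro Δ Ξ f h
    induction h with
    | @point s Θ h =>
      intro X hX hf
      obtain rfl := hX s ((PMF.mem_support_pure_iff _ _).2 rfl)
      rcases h with h | rfl
      · exact step _ _ _ h.1 hf
      · rw [PMF.pure_bind]
        exact hf _ ((PMF.mem_support_pure_iff _ _).2 rfl)
    | linear p Δ Θ _ ih =>
      intro X hX hf
      rw [PMF.bind_bind]
      exact conv' _ _ _ _ fun i hi => ih i X
        (fun s hs => hX s (PMF.support_bind_subset p Δ hi hs))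
        fun s hs => hf s (PMF.support_bind_subset p Θ hi hs)
  -- The run is read from its source: the kernel of the first step splits the rest of the run over
  -- the intermediate states.
  have main : ∀ {Δ : PMF (Config S)}, WeakTau K Δ Θ →
      ∃ f, Θ = Δ.bind f ∧ ∀ Y ∈ Δ.support, G Y (f Y) := by
    intro Δ h
    induction h using Relation.ReflTransGen.head_induction_on with
    | refl => exact ⟨PMF.pure, (PMF.bind_pure _).symm, fun Y hY => final Y (hF Y hY)⟩
    | head h _ ih =>
      obtain ⟨f, hf, hG⟩ := ih
      obtain ⟨g, rfl, hg⟩ := h.exists_kernel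
      refine ⟨fun Y => (g Y).bind f, by rw [hf, PMF.bind_bind], fun Y hY => ?_⟩
      refine lifted f (hg Y hY) Y (by simp) fun Z hZ => hG Z ?_
      exact (PMF.mem_support_bind_iff _ _ _).2 ⟨Y, hY, hZ⟩
  obtain ⟨f, rfl, hf⟩ := main h
  rw [PMF.pure_bind]
  exact hf X ((PMF.mem_support_pure_iff _ _).2 rfl)

/-! ## Inert parallel components -/

/-- The second clause is a default value; `left` is meaningful on parallel compositions only. -/
def Proc.left {N : Type} {m n : ℕ} : Proc S N m n → Proc S N m n
  | .par P _ => P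
  | P => P

def Config.left (C : Config S) : Config S := ⟨C.proc.left, C.state⟩

theorem Config.par_inj {C D : Config S} {P Q : CProc S} (h : C.par P = D.par Q) :
    C = D ∧ P = Q := by
  obtain ⟨P', ρ⟩ := C
  obtain ⟨Q', σ⟩ := D
  simp only [Config.par, Config.mk.injEq, Proc.par.injEq] at h
  obtain ⟨⟨rfl, rfl⟩, rfl⟩ := h
  exact ⟨rfl, rfl⟩

/-- `C ‖ 0 ‖ ⋯ ‖ 0`. -/
def Config.pad : ℕ → Config S → Config S
  | 0, C => C
  | n + 1, C => (C.pad n).par .nil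

/-- A total left inverse of `pad`, so that distributions over padded configurations can be mapped
back. -/
def Config.unpad : ℕ → Config S → Config S
  | 0, C => C
  | n + 1, C => C.left.unpad n

@[simp] theorem Config.unpad_pad (n : ℕ) (C : Config S) : (C.pad n).unpad n = C := by
  induction n with
  | zero => rfl
  | succ n ih => exact ih

theorem Config.has_pad (n : ℕ) (C : Config S) (a : QVar) :
    (C.pad n).proc.Has a ↔ C.proc.Has a := by
  induction n with
  | zero => rfl
  | succ n ih =>
    refine (Proc.has_par _ _ _).trans ?_
    rw [ih]
    exact or_iff_left (Proc.not_has_nil a)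

theorem Config.qv_pad (n : ℕ) (C : Config S) : (C.pad n).qv = C.qv :=
  Finset.ext fun a => C.has_pad n a

theorem Config.state_pad (n : ℕ) (C : Config S) : (C.pad n).state = C.state := by
  induction n with
  | zero => rfl
  | succ n ih => exact ih

theorem Config.ptr_pad (n : ℕ) (C : Config S) : (C.pad n).ptr = C.ptr := by
  unfold Config.ptr
  rw [Config.qv_pad, Config.state_pad]

theorem Config.legal_of_pad (n : ℕ) (C : Config S) (h : (C.pad n).proc.Legal) :
    C.proc.Legal := by
  induction n with
  | zero => exact h
  | succ n ih => exact ih h.2.1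

theorem Config.pad_applySO {V : Finset QVar} (E : SuperOp {q : QVar // q ∉ V}) (n : ℕ)
    (C : Config S) : (C.pad n).applySO E = (C.applySO E).pad n := by
  induction n with
  | zero => rfl
  | succ n ih =>
    change ((C.pad n).applySO E).par .nil = _
    rw [ih]
    rfl

theorem Trans.pad {α : Act S} {C : Config S} {Δ : PMF (Config S)} (h : Trans K α C Δ) (n : ℕ) :
    Trans K α (C.pad n) (Δ.map (Config.pad n)) := by
  induction n with
  | zero =>
    have : (Config.pad 0 : Config S → Config S) = id := rfl
    rw [this, PMF.map_id]
    exact h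
  | succ n ih =>
    refine ⟨?_, ?_⟩
    · have := Step.intL (P₂ := .nil) ih.1 (Finset.disjoint_empty_right _)
      rw [PMF.map_comp] at this
      exact this
    · rw [Config.qv_pad]
      exact h.2

/-- The process `0` can neither move nor communicate, so each transition stems from the innermost
component. -/
theorem Trans.of_pad {α : Act S} {C : Config S} (n : ℕ) {Δ : PMF (Config S)}
    (h : Trans K α (C.pad n) Δ) : ∃ Δ₀, Trans K α C Δ₀ ∧ Δ = Δ₀.map (Config.pad n) := by
  induction n generalizing Δ with
  | zero => exact ⟨Δ, h, (PMF.map_id Δ).symm⟩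
  | succ n ih =>
    obtain ⟨Δ₁, h₁, rfl⟩ := Step.par_nil h.1
    obtain ⟨Δ₀, h₀, rfl⟩ := ih ⟨h₁, by
      have := h.2
      rwa [Config.qv_pad] at this ⊢⟩
    exact ⟨Δ₀, h₀, by rw [PMF.map_comp]; rfl⟩

theorem Lift.of_pad {α : Act S} {n : ℕ} {Δ Θ : PMF (Config S)} (h : Lift (Trans K α) Δ Θ)
    (hΔ : ∀ X ∈ Δ.support, ∃ C : Config S, X = C.pad n) :
    Lift (Trans K α) (Δ.map (Config.unpad n)) (Θ.map (Config.unpad n)) ∧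
      ∀ X ∈ Θ.support, ∃ C : Config S, X = C.pad n := by
  constructor
  · refine h.map (P := fun X => ∃ C : Config S, X = C.pad n) ?_ hΔ
    rintro _ Θ ⟨C, rfl⟩ h
    obtain ⟨Θ₀, h₀, rfl⟩ := h.of_pad n
    rw [PMF.map_comp, Config.unpad_pad]
    have : Config.unpad n ∘ Config.pad n = (id : Config S → Config S) :=
      funext fun C => C.unpad_pad n
    rwa [this, PMF.map_id]
  · refine h.support_right ?_ hΔ
    rintro _ Θ ⟨C, rfl⟩ h X hX
    obtain ⟨Θ₀, -, rfl⟩ := h.of_pad n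
    obtain ⟨D, -, rfl⟩ := (PMF.mem_support_map_iff _ _ _).1 hX
    exact ⟨D, rfl⟩

theorem WeakTau.of_pad {n : ℕ} {Δ Θ : PMF (Config S)} (h : WeakTau K Δ Θ)
    (hΔ : ∀ X ∈ Δ.support, ∃ C : Config S, X = C.pad n) :
    WeakTau K (Δ.map (Config.unpad n)) (Θ.map (Config.unpad n)) ∧
      ∀ X ∈ Θ.support, ∃ C : Config S, X = C.pad n := by
  induction h with
  | refl => exact ⟨.refl, hΔ⟩
  | tail _ h ih =>
    refine ⟨ih.1.tail ?_, ?_⟩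
    · refine h.map (P := fun X => ∃ C : Config S, X = C.pad n) ?_ ih.2
      rintro _ Θ ⟨C, rfl⟩ (h | rfl)
      · obtain ⟨Θ₀, h₀, rfl⟩ := h.of_pad n
        rw [PMF.map_comp, Config.unpad_pad]
        have : Config.unpad n ∘ Config.pad n = (id : Config S → Config S) :=
          funext fun C => C.unpad_pad n
        rw [this, PMF.map_id]
        exact .inl h₀
      · exact .inr (PMF.pure_map _ _)
    · refine h.support_right ?_ ih.2
      rintro _ Θ ⟨C, rfl⟩ (h | rfl) X hX
      · obtain ⟨Θ₀, -, rfl⟩ := h.of_pad n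
        obtain ⟨D, -, rfl⟩ := (PMF.mem_support_map_iff _ _ _).1 hX
        exact ⟨D, rfl⟩
      · exact ⟨C, (PMF.mem_support_pure_iff _ _).1 hX⟩

theorem Weak.of_pad {α : Act S} {n : ℕ} {C : Config S} {Θ : PMF (Config S)}
    (h : Weak K α (PMF.pure (C.pad n)) Θ) :
    Weak K α (PMF.pure C) (Θ.map (Config.unpad n)) ∧
      ∀ X ∈ Θ.support, ∃ D : Config S, X = D.pad n := by
  have h₀ : ∀ X ∈ (PMF.pure (C.pad n)).support, ∃ C : Config S, X = C.pad n :=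
    fun X hX => ⟨C, (PMF.mem_support_pure_iff _ _).1 hX⟩
  have hp : (PMF.pure (C.pad n)).map (Config.unpad n) = PMF.pure C := by
    rw [PMF.pure_map, Config.unpad_pad]
  by_cases hα : α = .tau
  · subst hα
    have := WeakTau.of_pad h h₀
    rw [hp] at this
    exact this
  · rw [weak_iff hα] at h ⊢
    obtain ⟨Δ', Θ', h₁, h₂, h₃⟩ := h
    obtain ⟨k₁, k₁'⟩ := h₁.of_pad h₀
    obtain ⟨k₂, k₂'⟩ := h₂.of_pad k₁'
    obtain ⟨k₃, k₃'⟩ := h₃.of_pad k₂'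
    exact ⟨⟨_, _, hp ▸ k₁, k₂, k₃⟩, k₃'⟩

/-! ## Testing processes -/

/-- The set `P` of processes is closed under transitions, which go to single processes. -/
def StepClosed (K : Environment S) (P : CProc S → Prop) : Prop :=
  ∀ U, P U → ∀ ρ β Δ, Step K ⟨U, ρ⟩ β Δ → ∃ U', P U' ∧ Δ = PMF.pure ⟨U', ρ⟩

/-- The processes in `P` have internal transitions only, to processes in `P`. -/
def TauClosed (K : Environment S) (P : CProc S → Prop) : Prop :=
  ∀ U, P U → ∀ ρ β Δ, Step K ⟨U, ρ⟩ β Δ → β = .tau ∧ ∃ U', P U' ∧ Δ = PMF.pure ⟨U', ρ⟩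

theorem TauClosed.stepClosed {P : CProc S → Prop} (h : TauClosed K P) : StepClosed K P :=
  fun U hU ρ β Δ hs => (h U hU ρ β Δ hs).2

theorem Step.par_closed {P : CProc S → Prop} (hP : StepClosed K P) {Y : Config S} {U : CProc S}
    (hU : P U) {Δ : PMF (Config S)} (h : Step K (Y.par U) .tau Δ) :
    ∀ Z ∈ Δ.support, ∃ Y' U', Z = Config.par Y' U' ∧ P U' ∧
      ∀ a, Y'.proc.Has a → Y.proc.Has a ∨ ∃ β Ξ, Step K ⟨U, Y.state⟩ β Ξ ∧ a ∈ β.sent := by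
  intro Z hZ
  rcases h.par_tau with ⟨Δ₀, h₀, rfl⟩ | ⟨Δ₀, h₀, rfl⟩ | ⟨α, β, P', Q', hc, h₁, h₂, rfl⟩
  · obtain ⟨Y', hY', rfl⟩ := (PMF.mem_support_map_iff _ _ _).1 hZ
    refine ⟨Y', U, rfl, hU, fun a ha => (h₀.has Y' hY' a ha).imp_right fun h => ?_⟩
    exact absurd h (Finset.notMem_empty a)
  · obtain ⟨U', hU', rfl⟩ := hP U hU _ _ _ h₀
    rw [PMF.pure_map, PMF.mem_support_pure_iff] at hZ
    exact ⟨Y, U', hZ, hU', fun a ha => .inl ha⟩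
  · obtain ⟨U', hU', hU''⟩ := hP U hU _ _ _ h₂
    have : Q' = U' := by
      have := (PMF.mem_support_pure_iff _ _).1
        (hU'' ▸ (PMF.mem_support_pure_iff _ _).2 rfl : (⟨Q', Y.state⟩ : Config S) ∈ _)
      exact congrArg Config.proc this
    subst this
    rw [PMF.mem_support_pure_iff] at hZ
    refine ⟨⟨P', Y.state⟩, Q', hZ, hU', fun a ha => ?_⟩
    refine (h₁.has _ ((PMF.mem_support_pure_iff _ _).2 rfl) a ha).imp_right fun h => ?_
    refine ⟨_, _, h₂, ?_⟩
    cases hc with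
    | qin c r => exact h
    | _ => exact absurd h (Finset.notMem_empty a)

/-- Along internal transitions of `Y ‖ U`, the component `Y` acquires only variables that are
sent by the other component. -/
theorem WeakTau.par_closed {P : CProc S → Prop} (hP : StepClosed K P) {Y : Config S}
    {U : CProc S} (hU : P U) {V : QVar → Prop} 
    (hV : ∀ U, P U → ∀ ρ β Δ, Step K ⟨U, ρ⟩ β Δ → ∀ a ∈ β.sent, V a)
    {Θ : PMF (Config S)} (h : WeakTau K (PMF.pure (Y.par U)) Θ) :
    ∀ Z ∈ Θ.support, ∃ Y' U', Z = Config.par Y' U' ∧ P U' ∧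
      ∀ a, Y'.proc.Has a → Y.proc.Has a ∨ V a := by
  refine h.support (P := fun Z => ∃ Y' U', Z = Config.par Y' U' ∧ P U' ∧
      ∀ a, Y'.proc.Has a → Y.proc.Has a ∨ V a) ?_ ?_
  · rintro _ Δ ⟨Y₁, U₁, rfl, hU₁, hY₁⟩ hs Z hZ
    obtain ⟨Y', U', rfl, hU', hY'⟩ := hs.par_closed hP hU₁ Z hZ
    exact ⟨Y', U', rfl, hU', fun a ha =>
      (hY' a ha).elim (hY₁ a) fun ⟨β, Ξ, h, hβ⟩ => .inr (hV _ hU₁ _ β Ξ h a hβ)⟩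
  · intro Z hZ
    rw [PMF.mem_support_pure_iff] at hZ
    exact ⟨Y, U, hZ, hU, fun a ha => .inl ha⟩

/-- Next to a process with internal transitions only, `Y` moves independently. -/
theorem WeakTau.left {P : CProc S → Prop} (hP : TauClosed K P) {Y : Config S} {U : CProc S}
    (hU : P U) {Θ : PMF (Config S)} (h : WeakTau K (PMF.pure (Y.par U)) Θ) :
    WeakTau K (PMF.pure Y) (Θ.map Config.left) := by
  have main : ∀ {Δ Θ : PMF (Config S)}, WeakTau K Δ Θ →
      (∀ X ∈ Δ.support, ∃ Y U, X = Config.par Y U ∧ P U) →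
      WeakTau K (Δ.map Config.left) (Θ.map Config.left) ∧
      ∀ X ∈ Θ.support, ∃ Y U, X = Config.par Y U ∧ P U := by
    intro Δ Θ h hΔ
    induction h with
    | refl => exact ⟨.refl, hΔ⟩
    | tail _ h ih =>
      refine ⟨ih.1.tail (h.map (P := fun X => ∃ Y U, X = Config.par Y U ∧ P U) ?_ ih.2),
        h.support_right ?_ ih.2⟩
      · rintro _ Θ ⟨Y, U, rfl, hU⟩ (h | rfl)
        · rcases h.1.par_tau with ⟨Δ₀, h₀, rfl⟩ | ⟨Δ₀, h₀, rfl⟩ |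
            ⟨α, β, P', Q', hc, h₁, h₂, rfl⟩
          · rw [PMF.map_comp]
            exact .inl (.of_tau ((PMF.map_id Δ₀).symm ▸ h₀))
          -- A move of the neighbour alone becomes an idle step of `Y`; a synchronisation is
          -- impossible because `Co` does not involve `tau`.
          · obtain ⟨-, U', hU', rfl⟩ := hP U hU _ _ _ h₀
            rw [PMF.pure_map, PMF.pure_map]
            exact .inr rfl
          · obtain ⟨rfl, -⟩ := hP U hU _ _ _ h₂
            cases hc
        · exact .inr (PMF.pure_map _ _)
      · rintro _ Θ ⟨Y, U, rfl, hU⟩ (h | rfl) Z hZ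
        · obtain ⟨Y', U', rfl, hU', -⟩ := h.1.par_closed hP.stepClosed hU Z hZ
          exact ⟨Y', U', rfl, hU'⟩
        · exact ⟨Y, U, (PMF.mem_support_pure_iff _ _).1 hZ, hU⟩
  have := (main h fun X hX => ⟨Y, U, (PMF.mem_support_pure_iff _ _).1 hX, hU⟩).1
  rwa [PMF.pure_map] at this

/-- `T` is a test for the action `α`: its first transition leads to a process in `Good` if it
synchronises with `α`, and may otherwise lead to a process in `Bad`; afterwards there are only
internal transitions. -/
structure IsTest (K : Environment S) (α : Act S) (T : CProc S) (Good Bad : CProc S → Prop) :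
    Prop where
  start : ∀ ρ β Δ, Step K ⟨T, ρ⟩ β Δ → ∃ U, Δ = PMF.pure ⟨U, ρ⟩ ∧ β ≠ .tau ∧
    ((∀ a, Co a β → a = α) ∧ Good U ∨ Bad U)
  good : TauClosed K Good
  bad : TauClosed K Bad

theorem IsTest.stepClosed {α : Act S} {T : CProc S} {Good Bad : CProc S → Prop}
    (h : IsTest K α T Good Bad) : StepClosed K fun U => U = T ∨ Good U ∨ Bad U := by
  rintro U (rfl | hU | hU) ρ β Δ hs
  · obtain ⟨U', rfl, -, ⟨-, h⟩ | h⟩ := h.start ρ β Δ hs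
    · exact ⟨U', .inr (.inl h), rfl⟩
    · exact ⟨U', .inr (.inr h), rfl⟩
  · obtain ⟨-, U', h, rfl⟩ := h.good U hU ρ β Δ hs
    exact ⟨U', .inr (.inl h), rfl⟩
  · obtain ⟨-, U', h, rfl⟩ := h.bad U hU ρ β Δ hs
    exact ⟨U', .inr (.inr h), rfl⟩

/-- If `Y ‖ T` reaches only configurations `Y' ‖ U` where `U` witnesses that the test `T` for `α`
has succeeded, then `Y` can perform `α`. -/
theorem IsTest.weak {α : Act S} (hα : α ≠ .tau) {T : CProc S} {Good Bad F : CProc S → Prop}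
    (h : IsTest K α T Good Bad) (hF : ∀ U, F U → ¬ Bad U ∧ U ≠ T) {Y : Config S}
    (hY : ∀ a ∈ α.qbv, ¬ Y.proc.Has a) {Θ : PMF (Config S)}
    (hw : WeakTau K (PMF.pure (Y.par T)) Θ)
    (hΘ : ∀ Z ∈ Θ.support, ∃ Y U, Z = Config.par Y U ∧ F U) :
    Weak K α (PMF.pure Y) (Θ.map Config.left) := by
  -- The induction follows the state of the test. After success the rest of the run projects to
  -- internal moves of `Y`; a failed test never reaches `F`; before the synchronisation the run
  -- still yields a weak `α` transition. The freshness of the variables bound in `α` belongs to the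
  -- invariant because `Trans` demands it when `α` occurs.
  have main := WeakTau.induction_of_pure (F := fun Z => ∃ Y U, Z = Config.par Y U ∧ F U)
    (G := fun X Θ => ∀ Y U, X = Config.par Y U →
      (Good U → WeakTau K (PMF.pure Y) (Θ.map Config.left)) ∧ ¬ Bad U ∧
      (U = T → (∀ a ∈ α.qbv, ¬ Y.proc.Has a) → Weak K α (PMF.pure Y) (Θ.map Config.left)))
    ?_ ?_ ?_ hw hΘ
  · exact (main Y T rfl).2.2 rfl hY
  · rintro _ ⟨Y', U', rfl, hU⟩ Y U hX
    obtain ⟨rfl, rfl⟩ := Config.par_inj hX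
    refine ⟨fun _ => ?_, (hF _ hU).1, fun h => absurd h (hF _ hU).2⟩
    rw [PMF.pure_map]
    exact .refl
  · rintro _ Δ f hs hf Y U rfl
    rcases hs.par_tau with ⟨Δ₀, h₀, rfl⟩ | ⟨Δ₀, h₀, rfl⟩ | ⟨a, β, P', Q', hc, h₁, h₂, rfl⟩
    · have hf' : ∀ Y' ∈ Δ₀.support, _ := fun Y' hY' =>
        hf (Y'.par U) ((PMF.mem_support_map_iff _ _ _).2 ⟨Y', hY', rfl⟩) Y' U rfl
      have hfin := h₀.finite_support
      rw [PMF.bind_map, PMF.map_bind]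
      have h₀' : WeakTau K (PMF.pure Y) (Δ₀.bind PMF.pure) := by
        rw [PMF.bind_pure]; exact .of_step h₀
      refine ⟨fun hU => ?_, fun hU => ?_, fun hU hY => ?_⟩
      · exact h₀'.trans (WeakTau.bind hfin (by simp) fun Y' hY' => (hf' Y' hY').1 hU)
      · obtain ⟨Y', hY'⟩ := Δ₀.support_nonempty
        exact (hf' Y' hY').2.1 hU
      · refine Weak.head hα h₀' (.bind hα hfin (by simp) fun Y' hY' =>
          (hf' Y' hY').2.2 hU fun a ha hYa => ?_)
        exact (h₀.has Y' hY' a hYa).elim (hY a ha) (Finset.notMem_empty a)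
    · refine ⟨fun hU => ?_, fun hU => ?_, fun hU hY => ?_⟩
      · obtain ⟨-, U', hU', rfl⟩ := h.good U hU _ _ _ h₀
        rw [PMF.pure_map] at hf ⊢
        rw [PMF.pure_bind]
        exact (hf _ ((PMF.mem_support_pure_iff _ _).2 rfl) Y U' rfl).1 hU'
      · obtain ⟨-, U', hU', rfl⟩ := h.bad U hU _ _ _ h₀
        rw [PMF.pure_map] at hf
        exact (hf _ ((PMF.mem_support_pure_iff _ _).2 rfl) Y U' rfl).2.1 hU'
      · subst hU
        obtain ⟨U', -, hβ, -⟩ := h.start _ _ _ h₀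
        exact absurd rfl hβ
    · have hf' := hf _ ((PMF.mem_support_pure_iff _ _).2 rfl) ⟨P', Y.state⟩ Q' rfl
      refine ⟨fun hU => ?_, fun hU => ?_, fun hU hY => ?_⟩
      · obtain ⟨rfl, -⟩ := h.good U hU _ _ _ h₂
        cases hc
      · obtain ⟨rfl, -⟩ := h.bad U hU _ _ _ h₂
        cases hc
      · subst hU
        rw [PMF.pure_bind]
        obtain ⟨U', hU', -, hgb⟩ := h.start _ _ _ h₂
        have hQ : (⟨Q', Y.state⟩ : Config S) = ⟨U', Y.state⟩ :=
          (PMF.mem_support_pure_iff _ _).1 (hU' ▸ (PMF.mem_support_pure_iff _ _).2 rfl)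
        obtain rfl : Q' = U' := congrArg Config.proc hQ
        -- This is the synchronisation with the test. In the good case `Y` has just performed `α`,
        -- and only internal moves remain; the bad case contradicts the invariant.
        rcases hgb with ⟨ha, hg⟩ | hb
        · obtain rfl := ha a hc
          refine (weak_iff hα).2 ⟨_, _, .refl, .point ⟨h₁, ?_⟩, hf'.1 hg⟩
          exact Finset.disjoint_left.2 fun b hb => hY b hb
        · exact absurd hb hf'.2.1
  · rintro X n p Θ hΘ Y U rfl
    have hi := fun i => hΘ i Y U rfl
    rw [PMF.map_bind]
    obtain ⟨i, -⟩ := p.support_nonempty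
    refine ⟨fun hU => ?_, (hi i).2.1, fun hU hY => ?_⟩
    · have := WeakTau.linear p (Δ := fun _ => PMF.pure Y) (by simp) fun i => (hi i).1 hU
      rwa [PMF.bind_const] at this
    · have := Weak.bind hα (q := p) (Set.toFinite _) (Δ := fun _ => PMF.pure Y) (by simp)
        fun i _ => (hi i).2.2 hU hY
      rwa [PMF.bind_const] at this

/-! ## Processes that hold a quantum variable -/

/-- The identity super-operator. -/
def SuperOp.id (ι : Type) : SuperOp ι where
  map := LinearMap.id
  completelyPositive _ _ h := h
  tracePreserving _ := rfl

/-- An inactive process in which the quantum variable `a` is free. -/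
def Proc.flag {N : Type} {m n : ℕ} (a : QRef N n) : Proc S N m n :=
  .ite .ff (.oper (SuperOp.id (Fin 1)) (fun _ => a) .nil)

/-- A process that releases the quantum variable `a` before it continues as `P`. -/
def Proc.hold {N : Type} {m n : ℕ} (a : QRef N n) (P : Proc S N m n) : Proc S N m n :=
  .sum (.tau P) (.flag a)

theorem Proc.has_flag (a b : QVar) : (Proc.flag (S := S) (m := 0) (n := 0) a).Has b ↔ a = b := by
  refine (Proc.has_oper _ _ _ _).trans ?_
  rw [or_iff_right (Proc.not_has_nil b)]
  exact ⟨fun ⟨_, h⟩ => h, fun h => ⟨0, h⟩⟩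

theorem Proc.has_hold (a b : QVar) (P : CProc S) :
    (Proc.hold (n := 0) a P).Has b ↔ P.Has b ∨ a = b := by
  refine (Proc.has_sum _ _ _).trans ?_
  rw [Proc.has_flag]
  rfl

theorem Proc.legal_flag {N : Type} {m n : ℕ} (a : QRef N n) :
    (Proc.flag a : Proc S N m n).Legal :=
  ⟨Nat.one_pos, fun _ _ _ => Subsingleton.elim _ _, trivial⟩

theorem Proc.legal_hold {N : Type} {m n : ℕ} (a : QRef N n) {P : Proc S N m n} (h : P.Legal) :
    (Proc.hold a P).Legal :=
  ⟨h, Proc.legal_flag a⟩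

theorem Step.not_flag {a : QVar} {ρ : Density QVar} {β : Act S} {Δ : PMF (Config S)} :
    ¬ Step K ⟨Proc.flag (n := 0) a, ρ⟩ β Δ := fun h => (Step.ite_inv h).2

theorem Step.hold_inv {a : QVar} {P : CProc S} {ρ : Density QVar} {β : Act S}
    {Δ : PMF (Config S)} (h : Step K ⟨Proc.hold (n := 0) a P, ρ⟩ β Δ) :
    β = .tau ∧ Δ = PMF.pure ⟨P, ρ⟩ :=
  (Step.sum_inv h).elim Step.tau_inv fun h => absurd h Step.not_flag

theorem Step.hold (a : QVar) (P : CProc S) (ρ : Density QVar) :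
    Step K ⟨Proc.hold (n := 0) a P, ρ⟩ .tau (PMF.pure ⟨P, ρ⟩) := .sumL (.tau P ρ)

theorem tauClosed_hold (a : QVar) :
    TauClosed K fun U : CProc S => U = Proc.hold (n := 0) a .nil ∨ U = .nil := by
  rintro U (rfl | rfl) ρ β Δ h
  · obtain ⟨rfl, rfl⟩ := h.hold_inv
    exact ⟨rfl, _, .inr rfl, rfl⟩
  · exact absurd h Step.not_nil

theorem tauClosed_false : TauClosed K fun _ : CProc S => False := fun _ h => h.elim

/-! ## Relations contained in reduction barbed congruence -/

/-- The closure properties of reduction barbed congruence that the argument needs. -/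
structure IsReductionCongruence (K : Environment S) (R : Config S → Config S → Prop) : Prop where
  legal : OnConfigs R
  closed : ReductionClosed K R
  comp : Compositional R
  env : SameEnv R

theorem IsReductionCongruence.flip {R : Config S → Config S → Prop}
    (h : IsReductionCongruence K R) : IsReductionCongruence K fun C D => R D C where
  legal C D hR := (h.legal D C hR).symm
  closed C D hR := by
    refine ⟨fun Δ hΔ => ?_, fun Θ hΘ => ?_⟩
    · obtain ⟨Θ, h₁, h₂⟩ := (h.closed D C hR).2 Δ hΔ
      exact ⟨Θ, h₁, h₂.flip⟩
    · obtain ⟨Δ, h₁, h₂⟩ := (h.closed D C hR).1 Θ hΘ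
      exact ⟨Δ, h₁, h₂.flip⟩
  comp := by
    refine ⟨fun C D hR Q hQ hd => h.comp.1 D C hR Q hQ (by rwa [Finset.union_comm]),
      fun C D hR => ?_⟩
    -- The type of the super-operators depends on the free variables of the first configuration,
    -- which are the same for both.
    rw [← (h.env D C hR).1]
    exact h.comp.2 D C hR
  env C D hR := ⟨(h.env D C hR).1.symm, (h.env D C hR).2.symm⟩

/-! ### Matching visible actions by means of tests -/

section Visible
variable {R : Config S → Config S → Prop} {C C' D : Config S} {α β : Act S}

theorem IsReductionCongruence.has_iff (h : IsReductionCongruence K R) (hR : R C D) (a : QVar) :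
    C.proc.Has a ↔ D.proc.Has a := by
  have := (h.env C D hR).1
  change a ∈ C.qv ↔ a ∈ D.qv
  rw [this]

theorem IsReductionCongruence.par (h : IsReductionCongruence K R) (hR : R C D) {T : CProc S}
    (hT : T.Legal) (hd : ∀ a, T.Has a → ¬ C.proc.Has a) : R (C.par T) (D.par T) := by
  refine h.comp.1 C D hR T hT ?_
  rw [(h.env C D hR).1, Finset.union_idempotent, ← (h.env C D hR).1]
  exact Finset.disjoint_left.2 hd

/-- A visible action of `C` is matched by `D` if there is a test for it that signals success by
releasing a fresh quantum variable. -/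
theorem IsReductionCongruence.match_of_test (h : IsReductionCongruence K R) (hR : R C D)
    (hα : α ≠ .tau) (hC : Trans K α C (PMF.pure C')) (hst : C'.state = C.state)
    {T : CProc S} {Good Bad : CProc S → Prop} (ht : IsTest K α T Good Bad) (hT : T.Legal)
    (hd : ∀ a, T.Has a → ¬ C.proc.Has a) {s : QVar} (hTs : T.Has s) (hB : ∀ U, Bad U → U.Has s)
    (hG : ∀ U, Good U → ¬ U.Has s → U = .nil) (hc : Co α β)
    {U₀ : CProc S} (hstep : Step K ⟨T, C.state⟩ β (PMF.pure ⟨U₀, C.state⟩))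
    (hstep' : Step K ⟨U₀, C.state⟩ .tau (PMF.pure ⟨.nil, C.state⟩))
    (hs : ¬ C'.proc.Has s) :
    ∃ Θ, Weak K α (PMF.pure D) Θ ∧
      LiftRel (fun X Y => R (X.par .nil) (Y.par .nil)) (PMF.pure C') Θ := by
  obtain ⟨P', ρ⟩ := C'
  obtain ⟨P, ρ'⟩ := C
  obtain rfl : ρ = ρ' := hst
  have hw : WeakTau K (PMF.pure (Config.par ⟨P, ρ⟩ T)) (PMF.pure (Config.par ⟨P', ρ⟩ .nil)) := by
    refine (WeakTau.of_step (Step.sync hc hC.1 hstep)).trans (WeakTau.of_step ?_)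
    have := Step.intR (P₁ := P') hstep' (Finset.disjoint_empty_left _)
    rwa [PMF.pure_map] at this
  obtain ⟨Θ, hΘ, hL⟩ := (h.closed _ _ (h.par hR hT hd)).1 _ hw
  have hΘnil : ∀ Z ∈ Θ.support, ∃ Y U, Z = Config.par Y U ∧ U = Proc.nil := by
    intro Z hZ
    have hRZ := hL.rel_of_pure Z hZ
    obtain ⟨Y, U, rfl, hU, -⟩ :=
      hΘ.par_closed ht.stepClosed (.inl rfl) (V := fun _ => True) (by simp) Z hZ
    -- The variable `s` is not free in `C' ‖ 0`, hence not in the related `Y ‖ U`: each branch of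
    -- the answer has released it.
    have hUs : ¬ U.Has s := fun hUs => by
      have := (h.has_iff hRZ s).2 ((Proc.has_par _ _ _).2 (.inr hUs))
      exact ((Proc.has_par _ _ _).1 this).elim hs (Proc.not_has_nil s)
    refine ⟨Y, U, rfl, ?_⟩
    rcases hU with rfl | hU | hU
    · exact absurd hTs hUs
    · exact hG U hU hUs
    · exact absurd (hB U hU) hUs
  have hweak := ht.weak hα (F := fun U => U = .nil)
    (by
      rintro U rfl
      exact ⟨fun hb => Proc.not_has_nil s (hB _ hb), fun he => Proc.not_has_nil s (he ▸ hTs)⟩)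
    (Y := D) (fun a ha hD => Finset.disjoint_left.1 hC.2 ha ((h.has_iff hR a).2 hD)) hΘ hΘnil
  refine ⟨_, hweak, LiftRel.of_pure (hweak.finite (by simp)) fun Y hY => ?_⟩
  obtain ⟨Z, hZ, rfl⟩ := (PMF.mem_support_map_iff _ _ _).1 hY
  obtain ⟨Y, U, rfl, rfl⟩ := hΘnil Z hZ
  exact hL.rel_of_pure _ hZ

/-- The test sends `v` on `c` and then releases `s`. It has no other first action, so no bad states
are needed. -/
theorem IsReductionCongruence.match_cin (h : IsReductionCongruence K R) (hR : R C D)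
    {c : S.CChan} {v : ℝ} (hC : Trans K (.cin c v) C (PMF.pure C')) (hst : C'.state = C.state) :
    ∃ Θ, Weak K (.cin c v) (PMF.pure D) Θ ∧
      LiftRel (fun X Y => R (X.par .nil) (Y.par .nil)) (PMF.pure C') Θ := by
  obtain ⟨s, hs⟩ := Infinite.exists_notMem_finset (C.qv ∪ C'.qv)
  rw [Finset.notMem_union] at hs
  refine h.match_of_test hR (by simp) hC hst (s := s)
    (T := .cout c (.val v) (.hold (n := 0) s .nil))
    (Good := fun U => U = Proc.hold (n := 0) s .nil ∨ U = .nil) (Bad := fun _ => False)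
    ⟨?_, tauClosed_hold s, tauClosed_false⟩ ?_ ?_ ?_ (fun _ h => h.elim) ?_ (.cin c v)
    (.cOutp _ _ _ _) (.hold _ _ _) hs.2
  · intro ρ β Δ hs
    obtain ⟨rfl, rfl⟩ := hs.cout_inv
    exact ⟨_, rfl, by simp, .inl ⟨by rintro _ ⟨⟩; rfl, .inl rfl⟩⟩
  · exact Proc.legal_hold (n := 0) s trivial
  · intro a ha
    obtain rfl := ((Proc.has_hold _ _ _).1 ha).resolve_left (Proc.not_has_nil a)
    exact hs.1
  · exact (Proc.has_hold _ _ _).2 (.inr rfl)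
  · rintro U (rfl | rfl) hU
    · exact absurd ((Proc.has_hold _ _ _).2 (.inr rfl)) hU
    · rfl

/-- The test sends `r` and then releases `s`. It may own `r`, as the convention on bound variables
keeps `r` out of `C`; legality of the test requires `s ≠ r`. -/
theorem IsReductionCongruence.match_qin (h : IsReductionCongruence K R) (hR : R C D)
    {c : S.QChan} {r : QVar} (hC : Trans K (.qin c r) C (PMF.pure C')) (hst : C'.state = C.state) :
    ∃ Θ, Weak K (.qin c r) (PMF.pure D) Θ ∧
      LiftRel (fun X Y => R (X.par .nil) (Y.par .nil)) (PMF.pure C') Θ := by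
  obtain ⟨s, hs⟩ := Infinite.exists_notMem_finset ((C.qv ∪ C'.qv) ∪ {r})
  rw [Finset.notMem_union, Finset.notMem_union, Finset.notMem_singleton] at hs
  refine h.match_of_test hR (by simp) hC hst (s := s)
    (T := .qout (n := 0) c r (.hold (n := 0) s .nil))
    (Good := fun U => U = Proc.hold (n := 0) s .nil ∨ U = .nil) (Bad := fun _ => False)
    ⟨?_, tauClosed_hold s, tauClosed_false⟩ ?_ ?_ ?_ (fun _ h => h.elim) ?_ (.qin c r)
    (.qOutp _ _ _ _) (.hold _ _ _) hs.1.2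
  · intro ρ β Δ hs
    obtain ⟨rfl, rfl⟩ := hs.qout_inv
    exact ⟨_, rfl, by simp, .inl ⟨by rintro _ ⟨⟩; rfl, .inl rfl⟩⟩
  · refine ⟨fun hr => ?_, Proc.legal_hold (n := 0) s trivial⟩
    exact hs.2 (((Proc.has_hold _ _ _).1 hr).resolve_left (Proc.not_has_nil r))
  · intro a ha
    rcases (Proc.has_qout _ _ _ _).1 ha with rfl | ha
    · exact fun hCa => Finset.disjoint_left.1 hC.2 (Finset.mem_singleton_self _) hCa
    · obtain rfl := ((Proc.has_hold _ _ _).1 ha).resolve_left (Proc.not_has_nil a)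
      exact hs.1.1
  · exact (Proc.has_qout _ _ _ _).2 (.inr ((Proc.has_hold _ _ _).2 (.inr rfl)))
  · rintro U (rfl | rfl) hU
    · exact absurd ((Proc.has_hold _ _ _).2 (.inr rfl)) hU
    · rfl

/-- The test receives a value and compares it with `v`. After a wrong value it is stuck and holds
`s` forever. -/
theorem IsReductionCongruence.match_cout (h : IsReductionCongruence K R) (hR : R C D)
    {c : S.CChan} {v : ℝ} (hC : Trans K (.cout c v) C (PMF.pure C')) (hst : C'.state = C.state) :
    ∃ Θ, Weak K (.cout c v) (PMF.pure D) Θ ∧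
      LiftRel (fun X Y => R (X.par .nil) (Y.par .nil)) (PMF.pure C') Θ := by
  obtain ⟨s, hs⟩ := Infinite.exists_notMem_finset (C.qv ∪ C'.qv)
  rw [Finset.notMem_union] at hs
  let guard : ℝ → CProc S := fun w =>
    .ite (.cmp .eq (.val w) (.val v)) (.hold (n := 0) s .nil)
  have hguard : ∀ w ρ β Δ, Step K ⟨guard w, ρ⟩ β Δ →
      w = v ∧ β = .tau ∧ Δ = PMF.pure ⟨.nil, ρ⟩ := fun w ρ β Δ h =>
    ⟨(Step.ite_inv h).2, (Step.ite_inv h).1.hold_inv⟩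
  have hgs : ∀ w a, (guard w).Has a ↔ s = a := fun w a =>
    (Proc.has_hold s a .nil).trans (or_iff_right (Proc.not_has_nil a))
  refine h.match_of_test hR (by simp) hC hst (s := s)
    (T := .cin c (.ite (.cmp .eq (.var 0) (.val v)) (.hold (n := 0) s .nil)))
    (Good := fun U => U = guard v ∨ U = .nil) (Bad := fun U => ∃ w, w ≠ v ∧ U = guard w)
    ⟨?_, ?_, ?_⟩ ?_ ?_ ?_ ?_ ?_ (.cout c v)
    (U₀ := guard v) (.cInp _ _ _ _) (.cho _ (.hold _ _ _) rfl) hs.2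
  · intro ρ β Δ hs
    obtain ⟨w, rfl, rfl⟩ := hs.cin_inv
    refine ⟨guard w, rfl, by simp, ?_⟩
    by_cases hw : w = v
    · subst hw
      exact .inl ⟨by rintro _ ⟨⟩; rfl, .inl rfl⟩
    · exact .inr ⟨w, hw, rfl⟩
  · rintro U (rfl | rfl) ρ β Δ h
    · obtain ⟨-, rfl, rfl⟩ := hguard _ _ _ _ h
      exact ⟨rfl, _, .inr rfl, rfl⟩
    · exact absurd h Step.not_nil
  · rintro _ ⟨w, hw, rfl⟩ ρ β Δ h
    exact absurd (hguard _ _ _ _ h).1 hw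
  · exact Proc.legal_hold (n := 0) s trivial
  · intro a ha
    obtain rfl := (hgs 0 a).1 ha
    exact hs.1
  · exact (hgs 0 s).2 rfl
  · rintro _ ⟨w, -, rfl⟩
    exact (hgs w s).2 rfl
  · rintro U (rfl | rfl) hU
    · exact absurd ((hgs _ _).2 rfl) hU
    · rfl

/-- The test receives some `q`, releases `s`, and then gives up `t` and `q` in one step. The loss of
`s` shows that the input has happened, and the presence of `t` that `q` is still held. At this point
the free variables of the whole still do not reveal which variable was handed over, since `q` and
`r` may both be present; they do once the test has let go of `q`. A single stage would not suffice:
sending `r` and then discarding `q` ends with the same free variables as sending `q` and then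
discarding `r`. -/
theorem IsReductionCongruence.match_qout (h : IsReductionCongruence K R) (hR : R C D)
    {c : S.QChan} {r : QVar} (hC : Trans K (.qout c r) C (PMF.pure C'))
    (hst : C'.state = C.state) :
    ∃ Θ, Weak K (.qout c r) (PMF.pure D) Θ ∧
      LiftRel (fun X Y => R (X.par .nil) (Y.par .nil)) (PMF.pure C') Θ := by
  obtain ⟨s, hs⟩ := Infinite.exists_notMem_finset (C.qv ∪ C'.qv)
  obtain ⟨t, ht⟩ := Infinite.exists_notMem_finset ((C.qv ∪ C'.qv) ∪ {s})
  rw [Finset.notMem_union] at hs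
  rw [Finset.notMem_union, Finset.notMem_union, Finset.notMem_singleton] at ht
  obtain ⟨⟨htC, htC'⟩, hts⟩ := ht
  obtain ⟨hsC, hsC'⟩ := hs
  obtain ⟨P', ρ⟩ := C'
  obtain ⟨P, ρ'⟩ := C
  obtain rfl : ρ = ρ' := hst
  have hrP : P.Has r := hC.1.has_of_mem_sent r (Finset.mem_singleton_self r)
  let second : QVar → CProc S := fun q =>
    .sum (.hold (n := 0) t .nil) (.flag (n := 0) q)
  let first : QVar → CProc S := fun q => .hold (n := 0) s (second q)
  let T : CProc S := .qin c (.hold (n := 1) (some s)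
    (.sum (.hold (n := 1) (some t) .nil) (.flag (n := 1) none)))
  have h2has : ∀ q a, (second q).Has a ↔ t = a ∨ q = a := fun q a => by
    refine (Proc.has_sum _ _ _).trans ?_
    rw [Proc.has_hold, Proc.has_flag, or_iff_right (Proc.not_has_nil a)]
  have h1has : ∀ q a, (first q).Has a ↔ (t = a ∨ q = a) ∨ s = a := fun q a => by
    rw [← h2has]
    exact Proc.has_hold s a (second q)
  have hThas : ∀ a, T.Has a ↔ s = a ∨ t = a := fun a => by
    change a ∈ Finset.eraseNone _ ↔ _
    rw [Finset.mem_eraseNone]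
    simp [Proc.hold, Proc.flag, Proc.qv, eq_comm, or_comm]
  have h2step : ∀ q ρ β Δ, Step K ⟨second q, ρ⟩ β Δ → β = .tau ∧ Δ = PMF.pure ⟨.nil, ρ⟩ :=
    fun q ρ β Δ h => (Step.sum_inv h).elim Step.hold_inv fun h => absurd h Step.not_flag
  have hclosed : ∀ V : QVar → Prop, TauClosed K fun U : CProc S =>
      (∃ q, V q ∧ (U = first q ∨ U = second q)) ∨ U = .nil := by
    rintro V U (⟨q, hq, rfl | rfl⟩ | rfl) ρ β Δ h
    · obtain ⟨rfl, rfl⟩ := h.hold_inv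
      exact ⟨rfl, _, .inl ⟨q, hq, .inr rfl⟩, rfl⟩
    · obtain ⟨rfl, rfl⟩ := h2step _ _ _ _ h
      exact ⟨rfl, _, .inr rfl, rfl⟩
    · exact absurd h Step.not_nil
  have htest : IsTest K (.qout c r) T
      (fun U => (∃ q, q = r ∧ (U = first q ∨ U = second q)) ∨ U = .nil)
      (fun U => (∃ q, (q ≠ r ∧ q ≠ t) ∧ (U = first q ∨ U = second q)) ∨ U = .nil) := by
    refine ⟨fun ρ β Δ hs => ?_, hclosed _, hclosed _⟩
    obtain ⟨q, hq, rfl, rfl⟩ := hs.qin_inv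
    refine ⟨first q, rfl, by simp, ?_⟩
    by_cases hqr : q = r
    · subst hqr
      exact .inl ⟨by rintro _ ⟨⟩; rfl, .inl ⟨q, rfl, .inl rfl⟩⟩
    · refine .inr (.inl ⟨q, ⟨hqr, ?_⟩, .inl rfl⟩)
      -- The test owns `t`, so the rule for quantum input prevents it from receiving `t`.
      rintro rfl
      exact hq ((hThas q).2 (.inr rfl))
  have hrt : r ≠ t := by rintro rfl; exact htC hrP
  have hrs : r ≠ s := by rintro rfl; exact hsC hrP
  have hT : T.Legal :=
    Proc.legal_hold (n := 1) _ ⟨Proc.legal_hold (n := 1) _ trivial, Proc.legal_flag (n := 1) _⟩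
  have hsend : ∀ U : CProc S, (U = T ∨
      ((∃ q, q = r ∧ (U = first q ∨ U = second q)) ∨ U = .nil) ∨
      ((∃ q, (q ≠ r ∧ q ≠ t) ∧ (U = first q ∨ U = second q)) ∨ U = .nil)) →
      ∀ ρ β Δ, Step K ⟨U, ρ⟩ β Δ → ∀ a ∈ β.sent, False := by
    rintro U (rfl | hU | hU) ρ β Δ h a ha
    · obtain ⟨q, -, rfl, -⟩ := h.qin_inv
      exact Finset.notMem_empty a ha
    · obtain ⟨rfl, -⟩ := htest.good U hU _ _ _ h
      exact Finset.notMem_empty a ha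
    · obtain ⟨rfl, -⟩ := htest.bad U hU _ _ _ h
      exact Finset.notMem_empty a ha
  -- the first stage: `s` is released
  have hw₁ : WeakTau K (PMF.pure (Config.par ⟨P, ρ⟩ T))
      (PMF.pure (Config.par ⟨P', ρ⟩ (second r))) := by
    refine (WeakTau.of_step (Step.sync (.qout c r) hC.1
      (.qInp (K := K) c _ ρ r fun hr => ?_))).trans (WeakTau.of_step ?_)
    · exact ((hThas r).1 hr).elim (fun h => hrs h.symm) fun h => hrt h.symm
    · have := Step.intR (P₁ := P') (Step.hold (K := K) s (second r) ρ)
        (Finset.disjoint_empty_left _)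
      rwa [PMF.pure_map] at this
  have hRT : R (Config.par ⟨P, ρ⟩ T) (D.par T) := h.par hR hT fun a ha => by
    rcases (hThas a).1 ha with rfl | rfl
    · exact hsC
    · exact htC
  obtain ⟨Θ₁, hΘ₁, hL₁⟩ := (h.closed _ _ hRT).1 _ hw₁
  -- the second stage: `t` and the received variable are released
  have hw₂ : WeakTau K (PMF.pure (Config.par ⟨P', ρ⟩ (second r)))
      (PMF.pure (Config.par ⟨P', ρ⟩ .nil)) := by
    have := Step.intR (P₁ := P') (.sumL (P₂ := .flag (n := 0) r) (Step.hold (K := K) t .nil ρ))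
      (Finset.disjoint_empty_left _)
    rw [PMF.pure_map] at this
    exact .of_step this
  have hstage : ∀ Z ∈ Θ₁.support, ∃ Y, Z = Config.par Y (second r) ∧ ∃ Θ,
      WeakTau K (PMF.pure Y) Θ ∧ ∀ Y' ∈ Θ.support, R (Config.par ⟨P', ρ⟩ .nil) (Y'.par .nil) := by
    intro Z hZ
    have hRZ := hL₁.rel_of_pure Z hZ
    obtain ⟨Y, U, rfl, hU, hYD⟩ :=
      hΘ₁.par_closed htest.stepClosed (.inl rfl) hsend Z hZ
    have hZs : ¬ (Config.par Y U).proc.Has s := fun hs => by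
      rcases (Proc.has_par _ _ _).1 ((h.has_iff hRZ s).2 hs) with hs | hs
      · exact hsC' hs
      · rcases (h2has _ _).1 hs with hs | hs
        · exact hts hs
        · exact hrs hs
    have hUs : ¬ U.Has s := fun h => hZs ((Proc.has_par _ _ _).2 (.inr h))
    -- The variable `t` is free in the whole. It cannot belong to `Y`, because it is not free in `D`
    -- and the test sends nothing.
    have hUt : U.Has t := by
      have := (h.has_iff hRZ t).1 ((Proc.has_par _ _ _).2 (.inr ((h2has r t).2 (.inl rfl))))
      refine ((Proc.has_par _ _ _).1 this).resolve_left fun hY => ?_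
      exact htC ((h.has_iff hR t).2 ((hYD t hY).resolve_right id))
    -- The absence of `s` excludes the initial test and `first`, and the presence of `t` excludes
    -- `0`.
    have hU' : ∃ q, q ≠ t ∧ U = second q := by
      rcases hU with rfl | (⟨q, rfl, rfl | rfl⟩ | rfl) | ⟨q, hq, rfl | rfl⟩ | rfl
      · exact absurd ((hThas s).2 (.inl rfl)) hUs
      · exact absurd ((h1has _ s).2 (.inr rfl)) hUs
      · exact ⟨_, hrt, rfl⟩
      · exact absurd hUt (Proc.not_has_nil t)
      · exact absurd ((h1has _ s).2 (.inr rfl)) hUs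
      · exact ⟨_, hq.2, rfl⟩
      · exact absurd hUt (Proc.not_has_nil t)
    obtain ⟨q, hqt, rfl⟩ := hU'
    -- Related configurations are legal, so the parallel components `Y` and `second q` share no
    -- variable.
    have hYq : ¬ Y.proc.Has q := fun hY =>
      Finset.disjoint_left.1 (h.legal _ _ hRZ).2.1 hY ((h2has q q).2 (.inr rfl))
    obtain ⟨Θ, hΘ, hL⟩ := (h.closed _ _ hRZ).1 _ hw₂
    have hcl := hclosed fun q' => q' = q
    have hsecond : (∃ q', q' = q ∧ (second q = first q' ∨ second q = second q')) ∨
      second q = .nil := .inl ⟨q, rfl, .inr rfl⟩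
    have hnil : ∀ W ∈ Θ.support, ∃ Y', W = Config.par Y' .nil ∧
        ∀ a, Y'.proc.Has a → Y.proc.Has a := by
      intro W hW
      have hRW := hL.rel_of_pure W hW
      obtain ⟨Y', U', rfl, hU', hY'⟩ := hΘ.par_closed hcl.stepClosed hsecond
        (V := fun _ => False) (fun U hU ρ β Δ h a ha => by
          obtain ⟨rfl, -⟩ := hcl U hU _ _ _ h
          exact Finset.notMem_empty a ha) W hW
      refine ⟨Y', ?_, fun a ha => (hY' a ha).resolve_right id⟩
      have hUt : ¬ U'.Has t := fun hUt => by
        have := (h.has_iff hRW t).2 ((Proc.has_par _ _ _).2 (.inr hUt))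
        exact ((Proc.has_par _ _ _).1 this).elim htC' (Proc.not_has_nil t)
      rcases hU' with ⟨q', -, rfl | rfl⟩ | rfl
      · exact absurd ((h1has _ t).2 (.inl (.inl rfl))) hUt
      · exact absurd ((h2has _ t).2 (.inl rfl)) hUt
      · rfl
    -- Suppose `q ≠ r`. As `q` is free on the right, it is free in `P' ‖ second r`, hence in `P'`.
    -- After the second stage `q` is still free in `P' ‖ 0`, but on the right the test has dropped
    -- it, and `Y` did not own it and cannot have acquired it.
    have hqr : q = r := by
      by_contra hqr
      have hP'q : P'.Has q := by
        have := (h.has_iff hRZ q).2 ((Proc.has_par _ _ _).2 (.inr ((h2has q q).2 (.inr rfl))))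
        refine ((Proc.has_par _ _ _).1 this).resolve_right fun h => ?_
        rcases (h2has _ _).1 h with h | h
        · exact hqt h.symm
        · exact hqr h.symm
      obtain ⟨W, hW⟩ := Θ.support_nonempty
      have hRW := hL.rel_of_pure W hW
      obtain ⟨Y', rfl, hY'⟩ := hnil W hW
      have := (h.has_iff hRW q).1 ((Proc.has_par _ _ _).2 (.inl hP'q))
      exact hYq (hY' q (((Proc.has_par _ _ _).1 this).resolve_right (Proc.not_has_nil q)))
    refine ⟨Y, by rw [hqr], Θ.map Config.left, hΘ.left hcl hsecond, fun Y' hY' => ?_⟩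
    obtain ⟨W, hW, rfl⟩ := (PMF.mem_support_map_iff _ _ _).1 hY'
    have hRW := hL.rel_of_pure W hW
    obtain ⟨Y', rfl, -⟩ := hnil W hW
    exact hRW
  -- Success is measured at the end of the first stage, where the test is `second r`. The free
  -- variables distinguish this process from the initial test and from all bad states.
  have hweak := htest.weak (by simp) (F := fun U => U = second r)
    (by
      rintro U rfl
      refine ⟨?_, fun he => ?_⟩
      · rintro (⟨q, ⟨hqr, -⟩, he | he⟩ | he)
        · have := (h1has q s).2 (.inr rfl)
          rw [← he] at this
          rcases (h2has _ _).1 this with h | h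
          · exact hts h
          · exact hrs h
        · have := (h2has r r).2 (.inr rfl)
          rw [he] at this
          rcases (h2has _ _).1 this with h | h
          · exact hrt h.symm
          · exact hqr h
        · have := (h2has r r).2 (.inr rfl)
          rw [he] at this
          exact Proc.not_has_nil r this
      · have := (hThas s).2 (.inl rfl)
        rw [← he] at this
        rcases (h2has _ _).1 this with h | h
        · exact hts h
        · exact hrs h)
    (Y := D) (fun a ha => absurd ha (Finset.notMem_empty a)) hΘ₁
    fun Z hZ => by
      obtain ⟨Y, rfl, -⟩ := hstage Z hZ
      exact ⟨Y, _, rfl, rfl⟩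
  -- The internal moves of the second stage are chosen separately for each branch and appended to
  -- the weak output.
  have hstage' : ∀ Z, ∃ Θ, Z ∈ Θ₁.support → WeakTau K (PMF.pure Z.left) Θ ∧
      ∀ Y' ∈ Θ.support, R (Config.par ⟨P', ρ⟩ .nil) (Y'.par .nil) := by
    intro Z
    by_cases hZ : Z ∈ Θ₁.support
    · obtain ⟨Y, rfl, Θ, hΘ⟩ := hstage Z hZ
      exact ⟨Θ, fun _ => hΘ⟩
    · exact ⟨PMF.pure Z, fun h => absurd h hZ⟩
  choose f hf using hstage'
  have hfin := hΘ₁.finite (by simp)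
  have htail : WeakTau K (Θ₁.map Config.left) (Θ₁.bind f) :=
    WeakTau.bind hfin (by simp) fun Z hZ => (hf Z hZ).1
  have hfinal := hweak.tail (by simp) htail
  refine ⟨_, hfinal, LiftRel.of_pure (hfinal.finite (by simp)) fun Y hY => ?_⟩
  obtain ⟨Z, hZ, hYZ⟩ := (PMF.mem_support_bind_iff _ _ _).1 hY
  exact (hf Z hZ).2 Y hYZ

theorem IsReductionCongruence.match_visible (h : IsReductionCongruence K R) (hR : R C D)
    (hα : α ≠ .tau) {Δ : PMF (Config S)} (hC : Trans K α C Δ) :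
    ∃ Θ, Weak K α (PMF.pure D) Θ ∧
      LiftRel (fun X Y => R (X.par .nil) (Y.par .nil)) Δ Θ := by
  obtain ⟨P', rfl⟩ := hC.1.eq_pure hα
  cases α with
  | tau => exact absurd rfl hα
  | cin => exact h.match_cin hR hC rfl
  | cout => exact h.match_cout hR hC rfl
  | qin => exact h.match_qin hR hC rfl
  | qout => exact h.match_qout hR hC rfl

end Visible

/-! ## Completeness -/

/-- `R` up to inert parallel components. -/
def PadRel (R : Config S → Config S → Prop) (C D : Config S) : Prop :=
  ∃ n, R (C.pad n) (D.pad n)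

theorem Config.pad_add (m n : ℕ) (C : Config S) : C.pad (m + n) = (C.pad n).pad m := by
  induction m with
  | zero => rw [Nat.zero_add]; rfl
  | succ m ih =>
    rw [Nat.succ_add]
    exact congrArg (fun X : Config S => X.par .nil) ih

/-- With `V = C.qv` as a hypothesis, a super-operator typed by the free variables of an unpadded
configuration can be applied to the padded one. -/
theorem IsReductionCongruence.applySO {R : Config S → Config S → Prop}
    (h : IsReductionCongruence K R) {C D : Config S} (hR : R C D) {V : Finset QVar}
    (hV : V = C.qv) (E : SuperOp {q : QVar // q ∉ V}) : R (C.applySO E) (D.applySO E) := by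
  subst hV
  exact h.comp.2 C D hR E

theorem IsReductionCongruence.isOpenSimulation {R : Config S → Config S → Prop}
    (h : IsReductionCongruence K R) : IsOpenSimulation K (PadRel R) := by
  refine ⟨fun C D ⟨n, hR⟩ => ?_, fun C D ⟨n, hR⟩ E α Δ hC => ?_⟩
  · have := h.env _ _ hR
    rwa [Config.qv_pad, Config.qv_pad, Config.ptr_pad, Config.ptr_pad] at this
  · have hE := h.applySO hR (C.qv_pad n).symm E
    rw [Config.pad_applySO, Config.pad_applySO] at hE
    have hC' := hC.pad n
    -- Here `m` counts the components `0` added by the answer: none for an internal move, and one,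
    -- the remains of the test, for a visible action.
    obtain ⟨Θ, hΘ, m, hL⟩ : ∃ Θ, Weak K α (PMF.pure ((D.applySO E).pad n)) Θ ∧
        ∃ m, LiftRel (fun X Y => R (X.pad m) (Y.pad m)) (Δ.map (Config.pad n)) Θ := by
      by_cases hα : α = .tau
      · subst hα
        obtain ⟨Θ, h₁, h₂⟩ := (h.closed _ _ hE).1 _ (.of_step hC'.1)
        exact ⟨Θ, h₁, 0, h₂⟩
      · obtain ⟨Θ, h₁, h₂⟩ := h.match_visible hE hα hC'
        exact ⟨Θ, h₁, 1, h₂⟩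
    obtain ⟨hw, hpad⟩ := hΘ.of_pad
    refine ⟨_, hw, ?_⟩
    have hΔ : Δ = (Δ.map (Config.pad n)).map (Config.unpad n) := by
      rw [PMF.map_comp]
      refine (PMF.map_id Δ).symm.trans (congrArg Δ.map (funext fun C => ?_))
      exact (C.unpad_pad n).symm
    rw [hΔ]
    refine LiftRel.map (P := fun X => ∃ C : Config S, X = C.pad n)
      (Q := fun X => ∃ C : Config S, X = C.pad n) ?_ hL ?_ hpad
    · rintro _ _ ⟨X, rfl⟩ ⟨Y, rfl⟩ hXY
      rw [Config.unpad_pad, Config.unpad_pad]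
      refine ⟨m + n, ?_⟩
      rwa [Config.pad_add, Config.pad_add]
    · intro X hX
      obtain ⟨C, -, rfl⟩ := (PMF.mem_support_map_iff _ _ _).1 hX
      exact ⟨C, rfl⟩

end QCCS

theorem mainTheorem1 (S : QCCS.Signature) (K : QCCS.Environment S) (C D : QCCS.Config S)
    (h : QCCS.ReductionBarbedCongruent K C D) : QCCS.OpenBisimilar K C D := by
  obtain ⟨R, hconf, -, hclosed, hcomp, henv, hR⟩ := h
  have h : QCCS.IsReductionCongruence K R := ⟨hconf, hclosed, hcomp, henv⟩
  -- `PadRel` of the converse of `R` unfolds to the converse of `PadRel R`, so the same lemma serves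
  -- both directions; the given pair is related with no padding.
  refine ⟨QCCS.PadRel R, ⟨?_, h.isOpenSimulation, h.flip.isOpenSimulation⟩, 0, hR⟩
  rintro C D ⟨n, hR⟩
  exact ⟨C.legal_of_pad n (hconf _ _ hR).1, D.legal_of_pad n (hconf _ _ hR).2⟩
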